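/- **Theorem (recurrence relations).** Let $\lambda>0$ and $t_1,t_2\in(-\pi/2,\pi/2)$ with $t_1\neq t_2$, and for $j=1,2$ let $$w_j(x)=\frac{1}{2\pi}e^{2t_jx}\left|\Gamma(\lambda+ix)\right|^2,\qquad x\in\mathbb R .$$ For all integers $k_1,k_2\ge 0$ there is a unique monic polynomial $P_{k_1,k_2}$ (with real coefficients) of degree $k=k_1+k_2$ such that $$\int_{-\infty}^{\infty}P_{k_1,k_2}(x)\,x^m\,w_j(x)\,dx=0,\qquad m=0,\dots,k_j-1,\quad j=1,2$$ (the multiple Meixner–Pollaczek polynomial). Set $P_{-1,k_2}\equiv 0$ and $P_{k_1,-1}\equiv 0$ for all $k_1,k_2$, and, with $k=k_1+k_2$, put $$a_{k_1,k_2}^{t_1,t_2}=\frac{k+k_1+2\lambda}{2}\tan t_1+\frac{k_2}{2}\tan t_2,\qquad b_{k_1,k_2}^{t_1,t_2}=\frac{k+2\lambda-1}{4}\left(\frac{k_1}{\cos^2 t_1}+\frac{k_2}{\cos^2 t_2}\right),$$ $$c_{k_1,k_2}^{t_1,t_2}=\frac{k_1(k+2\lambda-1)(k+2\lambda-2)(\tan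 t_1-\tan t_2)}{8\cos^2 t_1}.$$ Then, for all integers $k_1,k_2\ge 0$ such that $k_2\ge 1$ or $k_1=0$, $$P_{k_1+1,k_2}(x)=\left(x-a_{k_1,k_2}^{t_1,t_2}\right)P_{k_1,k_2}(x)-b_{k_1,k_2}^{t_1,t_2}P_{k_1,k_2-1}(x)-c_{k_1,k_2}^{t_1,t_2}P_{k_1-1,k_2-1}(x),$$ and, for all integers $k_1,k_2\ge 0$ such that $k_1\ge 1$ or $k_2=0$, $$P_{k_1,k_2+1}(x)=\left(x-a_{k_2,k_1}^{t_2,t_1}\right)P_{k_1,k_2}(x)-b_{k_2,k_1}^{t_2,t_1}P_{k_1-1,k_2}(x)-c_{k_2,k_1}^{t_2,t_1}P_{k_1-1,k_2-1}(x).$$ In the remaining boundary cases, for all integers $k_1,k_2\ge 0$, $$P_{k_1+1,0}(x)=\left(x-a_{k_1,0}^{t_1,t_2}\right)P_{k_1,0}(x)-b_{k_1,0}^{t_1,t_2}P_{k_1-1,0}(x),$$ $$P_{0,k_2+1}(x)=\left(x-a_{k_2,0}^{t_2,t_1}\right)P_{0,k_2}(x)-b_{k_2,0}^{t_2,t_1}P_{0,k_2-1}(x).$$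 -/

import Mathlib

open Polynomial MeasureTheory

/-- The Meixner-Pollaczek weight `w(x) = (2π)⁻¹ exp (2 t x) |Γ(lam + i x)|²` on the real line. -/
noncomputable def mpWeight (lam t x : ℝ) : ℝ :=
  1 / (2 * Real.pi) * Real.exp (2 * t * x) *
    ‖Complex.Gamma ((lam : ℂ) + Complex.I * (x : ℂ))‖ ^ 2

/-- `P` is monic of degree `k₁ + k₂` and orthogonal to `x ^ m` for `m < k₁` with respect to the
weight with parameter `t₁`, and for `m < k₂` with respect to the weight with parameter `t₂`. For
`lam > 0` and `|t_j| < π / 2` the weights decay exponentially, so these integrals converge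
absolutely for every polynomial `P`. -/
structure IsMultipleMP (lam t₁ t₂ : ℝ) (k₁ k₂ : ℕ) (P : ℝ[X]) : Prop where
  monic : P.Monic
  natDegree_eq : P.natDegree = k₁ + k₂
  orthogonal_fst : ∀ m : ℕ, m < k₁ → ∫ x : ℝ, P.eval x * x ^ m * mpWeight lam t₁ x = 0
  orthogonal_snd : ∀ m : ℕ, m < k₂ → ∫ x : ℝ, P.eval x * x ^ m * mpWeight lam t₂ x = 0

open Classical in
/-- The multiple Meixner-Pollaczek polynomial with indices `k₁`, `k₂`, set to be `0` as soon as one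
of the indices is negative. -/
noncomputable def multipleMP (lam t₁ t₂ : ℝ) (k₁ k₂ : ℤ) : ℝ[X] :=
  if h : 0 ≤ k₁ ∧ 0 ≤ k₂ ∧ ∃ P : ℝ[X], IsMultipleMP lam t₁ t₂ k₁.toNat k₂.toNat P then
    h.2.2.choose
  else 0

/-- For nonnegative indices, `multipleMP` has the defining properties, provided that some polynomial
has them. -/
theorem multipleMP_spec {lam t₁ t₂ : ℝ} {k₁ k₂ : ℕ}
    (h : ∃ P : ℝ[X], IsMultipleMP lam t₁ t₂ k₁ k₂ P) :
    IsMultipleMP lam t₁ t₂ k₁ k₂ (multipleMP lam t₁ t₂ k₁ k₂) := by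
  have h' : 0 ≤ (k₁ : ℤ) ∧ 0 ≤ (k₂ : ℤ) ∧
      ∃ P : ℝ[X], IsMultipleMP lam t₁ t₂ (k₁ : ℤ).toNat (k₂ : ℤ).toNat P :=
    ⟨Int.natCast_nonneg k₁, Int.natCast_nonneg k₂, h⟩
  unfold multipleMP
  rw [dif_pos h']
  exact h'.2.2.choose_spec

/-- The recurrence coefficient `a`. -/
noncomputable def mpA (lam t₁ t₂ : ℝ) (k₁ k₂ : ℕ) : ℝ :=
  (((k₁ : ℝ) + k₂) + k₁ + 2 * lam) / 2 * Real.tan t₁ + (k₂ : ℝ) / 2 * Real.tan t₂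

/-- The recurrence coefficient `b`. -/
noncomputable def mpB (lam t₁ t₂ : ℝ) (k₁ k₂ : ℕ) : ℝ :=
  (((k₁ : ℝ) + k₂) + 2 * lam - 1) / 4 * (k₁ / Real.cos t₁ ^ 2 + k₂ / Real.cos t₂ ^ 2)

/-- The recurrence coefficient `c`. -/
noncomputable def mpC (lam t₁ t₂ : ℝ) (k₁ k₂ : ℕ) : ℝ :=
  k₁ * (((k₁ : ℝ) + k₂) + 2 * lam - 1) * (((k₁ : ℝ) + k₂) + 2 * lam - 2) *
    (Real.tan t₁ - Real.tan t₂) / (8 * Real.cos t₁ ^ 2)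

/-! Write `L` for integration against the weight with parameters `lam` and `s`. That weight
continues to a holomorphic function on `|Im z| < lam`, decaying exponentially on smaller closed
strips. Moving the line of integration by `± i/2` and using `Γ(z+1) = zΓ(z)` expresses the
functional for `lam + 1/2` through the one for `lam` in two ways (`mpIntegral_shift_up`,
`mpIntegral_shift_down`).

Hence the difference operator `mpRaise lam t` has an adjoint `mpLower t s` for every weight
parameter `s` (`mpIntegral_mpRaise_mul`). Raising maps monic polynomials to monic polynomials of
degree one higher. The adjoint is a multiple of a central difference when `s = t`, so it lowers
degrees; otherwise it preserves degrees up to the factor `sin (s - t) / cos t` on the leading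
coefficient. Raising `k₁` times with `t₁` and `k₂` times with `t₂`, starting from `1`, therefore
produces the orthogonal polynomial, a Rodrigues formula (`mpPoly`), and also its first moments not
forced to vanish, in closed form. These are nonzero because `t₁ ≠ t₂`, and induction then gives
normality of all indices (`eq_zero_of_mpOrtho`), hence uniqueness.

For the recurrence, normality reduces the claim to orthogonality of the remainder and one
coefficient comparison: the subleading coefficients fix `a`, the `t₁`-moment fixes `c`, and the
`t₂`-moment then fixes `b`. Boundary indices need fewer conditions. Exchanging the two weights gives
the other half. -/

/-! ### Contour shifts in a horizontal strip. -/

open Filter in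
/-- If `f` is holomorphic on a closed horizontal strip and decays exponentially there, the integrals
of `f` over the two boundary lines of the strip agree. -/
theorem integral_horizontal_shift {f : ℂ → ℂ} {c ε K : ℝ} (hε : 0 < ε)
    (hf : DifferentiableOn ℂ f {z | z.im ∈ Set.uIcc 0 c})
    (hb : ∀ x v : ℝ, v ∈ Set.uIcc 0 c → ‖f (x + v * Complex.I)‖ ≤ K * Real.exp (-ε * |x|))
    (h0 : Integrable fun x : ℝ => f x) (h1 : Integrable fun x : ℝ => f (x + c * Complex.I)) :
    ∫ x : ℝ, f (x + c * Complex.I) = ∫ x : ℝ, f x := by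
  have key : ∀ T : ℝ, (∫ x in (-T)..T, f x) - (∫ x in (-T)..T, f (x + c * Complex.I)) =
      Complex.I * (∫ y in (0 : ℝ)..c, f (-T + y * Complex.I)) -
        Complex.I * (∫ y in (0 : ℝ)..c, f (T + y * Complex.I)) := by
    intro T
    have := Complex.integral_boundary_rect_eq_zero_of_differentiableOn f (-T) (T + c * Complex.I)
      (hf.mono (by
        intro z hz
        have := hz.2
        simpa using this))
    simp only [Complex.neg_im, Complex.ofReal_im, neg_zero, Complex.ofReal_zero, zero_mul, add_zero,
      Complex.neg_re, Complex.ofReal_re, Complex.add_re, Complex.mul_re, Complex.I_re, mul_zero,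
      Complex.I_im, sub_zero, Complex.add_im, Complex.mul_im, mul_one, zero_add, smul_eq_mul,
      Complex.ofReal_neg] at this
    linear_combination this
  have hexp : Tendsto (fun T : ℝ => K * Real.exp (-ε * |T|) * |c - 0|) atTop (nhds 0) := by
    have : Tendsto (fun T : ℝ => Real.exp (-ε * |T|)) atTop (nhds 0) :=
      Real.tendsto_exp_atBot.comp
        (tendsto_abs_atTop_atTop.const_mul_atTop_of_neg (by linarith))
    simpa using (this.const_mul K).mul_const |c - 0|
  have side : ∀ s : ℝ, |s| = 1 → Tendsto (fun T : ℝ => Complex.I *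
      ∫ y in (0 : ℝ)..c, f ((s * T : ℝ) + y * Complex.I)) atTop (nhds 0) := by
    intro s hs
    refine squeeze_zero_norm (fun T => ?_) hexp
    rw [norm_mul, Complex.norm_I, one_mul]
    refine intervalIntegral.norm_integral_le_of_norm_le_const fun y hy => ?_
    have := hb (s * T) y (Set.uIoc_subset_uIcc hy)
    rwa [abs_mul, hs, one_mul] at this
  have hl := (side (-1) (by simp)).sub (side 1 (by simp))
  have hr := (intervalIntegral_tendsto_integral h0 tendsto_neg_atTop_atBot tendsto_id).sub
    (intervalIntegral_tendsto_integral h1 tendsto_neg_atTop_atBot tendsto_id)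
  have := tendsto_nhds_unique hr (hl.congr fun T => by
    rw [id, key T]; push_cast; simp only [neg_mul, one_mul])
  rw [sub_zero, sub_eq_zero] at this
  exact this.symm

/-! ### Exponential bounds for polynomials and for Gamma on vertical strips. -/

theorem exists_norm_eval_le_exp (p : ℂ[X]) {δ : ℝ} (hδ : 0 < δ) :
    ∃ K : ℝ, 0 ≤ K ∧ ∀ z : ℂ, ‖p.eval z‖ ≤ K * Real.exp (δ * ‖z‖) := by
  induction p using Polynomial.induction_on' with
  | add p q hp hq =>
    obtain ⟨K, hK, h⟩ := hp
    obtain ⟨K', hK', h'⟩ := hq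
    refine ⟨K + K', by positivity, fun z => ?_⟩
    rw [eval_add, add_mul]
    exact (norm_add_le _ _).trans (add_le_add (h z) (h' z))
  | monomial n a =>
    refine ⟨‖a‖ * (n.factorial / δ ^ n), by positivity, fun z => ?_⟩
    rw [eval_monomial, norm_mul, norm_pow, mul_assoc]
    gcongr
    have := Real.pow_div_factorial_le_exp (x := δ * ‖z‖) (by positivity) n
    rw [div_le_iff₀ (by positivity), mul_pow] at this
    rw [div_mul_eq_mul_div, le_div_iff₀ (by positivity)]
    linarith

/-- The reflection formula gives `|Γ(1/2 + iy)|² = π / cosh (πy)`. -/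
theorem norm_Gamma_half_add_le (y : ℝ) :
    ‖Complex.Gamma (1 / 2 + y * Complex.I)‖ ≤
      Real.sqrt (2 * Real.pi) * Real.exp (-(Real.pi / 2) * |y|) := by
  have h1 := Complex.Gamma_mul_Gamma_one_sub (1 / 2 + y * Complex.I)
  have h2 : (1 - (1 / 2 + y * Complex.I)) = (starRingEnd ℂ) (1 / 2 + y * Complex.I) := by
    rw [map_add, map_mul, Complex.conj_ofReal, Complex.conj_I, map_div₀, map_one, map_ofNat]; ring
  rw [h2, Complex.Gamma_conj, Complex.mul_conj, Complex.normSq_eq_norm_sq] at h1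
  have h3 : Complex.sin (Real.pi * (1 / 2 + y * Complex.I)) = (Real.cosh (Real.pi * y) : ℝ) := by
    rw [show (Real.pi : ℂ) * (1 / 2 + y * Complex.I) =
      ((Real.pi * y : ℝ) : ℂ) * Complex.I + Real.pi / 2 by push_cast; ring,
      Complex.sin_add_pi_div_two, Complex.cos_mul_I, Complex.ofReal_cosh]
  rw [h3] at h1
  have h4 : ‖Complex.Gamma (1 / 2 + y * Complex.I)‖ ^ 2 = Real.pi / Real.cosh (Real.pi * y) := by
    exact_mod_cast h1
  have h5 : Real.exp (Real.pi * |y|) / 2 ≤ Real.cosh (Real.pi * y) := by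
    rw [← Real.cosh_abs, abs_mul, abs_of_pos Real.pi_pos, Real.cosh_eq]
    linarith [Real.exp_pos (-(Real.pi * |y|))]
  refine le_of_sq_le_sq ?_ (by positivity)
  rw [h4, mul_pow, Real.sq_sqrt (by positivity), ← Real.exp_nat_mul, div_le_iff₀ (Real.cosh_pos _)]
  have h6 : Real.exp ((2 : ℕ) * (-(Real.pi / 2) * |y|)) * Real.exp (Real.pi * |y|) = 1 := by
    rw [← Real.exp_add, Real.exp_eq_one_iff]; push_cast; ring
  have := mul_le_mul_of_nonneg_left h5 (Real.exp_pos ((2 : ℕ) * (-(Real.pi / 2) * |y|))).le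
  nlinarith [Real.pi_pos]

theorem exists_norm_Gamma_nat_add_half_le (N : ℕ) {θ : ℝ} (hθ : θ < Real.pi / 2) :
    ∃ K : ℝ, 0 ≤ K ∧ ∀ y : ℝ, ‖Complex.Gamma ((N + 1 / 2 : ℝ) + y * Complex.I)‖ ≤
      K * Real.exp (-θ * |y|) := by
  induction N generalizing θ with
  | zero =>
    refine ⟨Real.sqrt (2 * Real.pi), by positivity, fun y => ?_⟩
    have := norm_Gamma_half_add_le y
    push_cast
    rw [zero_add]
    refine this.trans ?_
    gcongr
  | succ N ih =>
    -- The functional equation costs a linear factor; half of the gap between `θ` and `π/2` is spent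
    -- on absorbing it.
    obtain ⟨K, hK, h⟩ := ih (θ := (θ + Real.pi / 2) / 2) (by linarith)
    obtain ⟨K', hK', h'⟩ := exists_norm_eval_le_exp (C ((N : ℂ) + 1 / 2) + X * C Complex.I)
      (δ := (Real.pi / 2 - θ) / 2) (by linarith)
    refine ⟨K' * K, by positivity, fun y => ?_⟩
    have hne : ((N + 1 / 2 : ℝ) : ℂ) + y * Complex.I ≠ 0 := by
      intro h0
      have := congrArg Complex.re h0
      simp at this
      linarith [Nat.cast_nonneg (α := ℝ) N]
    rw [show (((N + 1 : ℕ) + 1 / 2 : ℝ) : ℂ) + y * Complex.I =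
      ((N + 1 / 2 : ℝ) + y * Complex.I) + 1 by push_cast; ring, Complex.Gamma_add_one _ hne,
      norm_mul]
    have h1 := h' y
    simp only [eval_add, eval_C, eval_mul, eval_X, Complex.norm_real, Real.norm_eq_abs] at h1
    calc _ ≤ (K' * Real.exp ((Real.pi / 2 - θ) / 2 * |y|)) *
        (K * Real.exp (-((θ + Real.pi / 2) / 2) * |y|)) := by
          refine mul_le_mul ?_ (h y) (norm_nonneg _) (by positivity)
          push_cast
          exact h1
      _ = K' * K * Real.exp (-θ * |y|) := by
          rw [mul_mul_mul_comm, ← Real.exp_add]; ring_nf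

-- The quotient `|Γ(σ + iy)| / Γ(σ)` increases with `σ`: in Euler's limit formula it becomes a
-- product of factors `(σ + j) / |σ + j + iy|`, each increasing. This carries the bound at
-- half-integers over to whole strips.
open Filter in
theorem norm_Gamma_mul_Gamma_le {a b : ℝ} (ha : 0 < a) (hab : a ≤ b) (y : ℝ) :
    ‖Complex.Gamma (a + y * Complex.I)‖ * Real.Gamma b ≤
      ‖Complex.Gamma (b + y * Complex.I)‖ * Real.Gamma a := by
  have hn : ∀ c : ℝ, 0 < c → ∀ n : ℕ, 0 < n → ‖Complex.GammaSeq (c + y * Complex.I) n‖ =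
      (n : ℝ) ^ c * n.factorial / ∏ j ∈ Finset.range (n + 1), ‖(c + y * Complex.I + j : ℂ)‖ := by
    intro c hc n hn
    rw [Complex.GammaSeq, norm_div, norm_mul, norm_prod, Complex.norm_natCast,
      Complex.norm_natCast_cpow_of_pos hn]
    simp
  refine le_of_tendsto_of_tendsto
    ((Complex.GammaSeq_tendsto_Gamma _).norm.mul (Real.GammaSeq_tendsto_Gamma b))
    ((Complex.GammaSeq_tendsto_Gamma _).norm.mul (Real.GammaSeq_tendsto_Gamma a)) ?_
  filter_upwards [eventually_gt_atTop 0] with n h0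
  have hb : 0 < b := ha.trans_le hab
  have hpos : ∀ c : ℝ, 0 < c → ∀ j : ℕ, 0 < ‖(c + y * Complex.I + j : ℂ)‖ := by
    intro c hc j
    rw [norm_pos_iff]
    intro h
    have := congrArg Complex.re h
    simp at this
    linarith [Nat.cast_nonneg (α := ℝ) j]
  rw [hn a ha n h0, hn b hb n h0, Real.GammaSeq, Real.GammaSeq, div_mul_div_comm, div_mul_div_comm,
    ← Finset.prod_mul_distrib, ← Finset.prod_mul_distrib,
    mul_comm ((n : ℝ) ^ a * _) ((n : ℝ) ^ b * _)]
  refine div_le_div_of_nonneg_left (by positivity)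
    (Finset.prod_pos fun j _ => mul_pos (hpos b hb j) (by positivity))
    (Finset.prod_le_prod (fun j _ => mul_nonneg (norm_nonneg _) (by positivity)) fun j _ => ?_)
  refine le_of_sq_le_sq ?_ (mul_nonneg (norm_nonneg _) (by positivity))
  have hsq : ∀ c : ℝ, ‖(c + y * Complex.I + j : ℂ)‖ ^ 2 = (c + j) ^ 2 + y ^ 2 := by
    intro c
    rw [← Complex.normSq_eq_norm_sq, Complex.normSq_apply]
    simp; ring
  rw [mul_pow, mul_pow, hsq, hsq]
  have : (a + j) ^ 2 ≤ (b + j) ^ 2 := by gcongr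
  nlinarith [sq_nonneg y]

theorem exists_norm_Gamma_le_exp {a b θ : ℝ} (ha : 0 < a) (hθ : θ < Real.pi / 2) :
    ∃ K : ℝ, 0 ≤ K ∧ ∀ σ ∈ Set.Icc a b, ∀ y : ℝ, ‖Complex.Gamma (σ + y * Complex.I)‖ ≤
      K * Real.exp (-θ * |y|) := by
  obtain ⟨N, hN⟩ := exists_nat_ge b
  obtain ⟨K, hK, h⟩ := exists_norm_Gamma_nat_add_half_le N hθ
  have hpos : 0 < Real.Gamma (N + 1 / 2) := Real.Gamma_pos_of_pos (by positivity)
  obtain ⟨M, hM⟩ := (isCompact_Icc (a := a) (b := b)).exists_bound_of_continuousOn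
    (f := Real.Gamma) (fun x hx => (Real.differentiableAt_Gamma fun m => by
      have := Nat.cast_nonneg (α := ℝ) m
      have := hx.1
      linarith).continuousAt.continuousWithinAt)
  refine ⟨K * |M| / Real.Gamma (N + 1 / 2), by positivity, fun σ hσ y => ?_⟩
  have h1 := norm_Gamma_mul_Gamma_le (a := σ) (b := N + 1 / 2) (ha.trans_le hσ.1)
    (by linarith [hσ.2]) y
  rw [div_mul_eq_mul_div, le_div_iff₀ hpos]
  refine h1.trans ?_
  have h2 : Real.Gamma σ ≤ |M| := (le_abs_self _).trans ((hM σ hσ).trans (le_abs_self _))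
  calc _ ≤ (K * Real.exp (-θ * |y|)) * |M| :=
        mul_le_mul (h y) h2 (Real.Gamma_pos_of_pos (ha.trans_le hσ.1)).le (by positivity)
    _ = _ := by ring

theorem integrable_exp_neg_mul_abs {ε : ℝ} (hε : 0 < ε) :
    Integrable fun x : ℝ => Real.exp (-ε * |x|) := by
  rw [← integrableOn_univ, ← Set.Iic_union_Ioi (a := (0 : ℝ))]
  refine IntegrableOn.union ?_ ?_
  · refine (integrableOn_exp_mul_Iic hε 0).congr_fun (fun x hx => ?_) measurableSet_Iic
    simp only [abs_of_nonpos (Set.mem_Iic.1 hx)]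
    ring_nf
  · refine (exp_neg_integrableOn_Ioi 0 hε).congr_fun (fun x hx => ?_) measurableSet_Ioi
    simp only [abs_of_pos (Set.mem_Ioi.1 hx)]

/-! ### Holomorphy and decay of the continued weight. -/

/-- The analytic continuation of `mpWeight` from the real line. -/
noncomputable def mpKernel (lam t : ℝ) (z : ℂ) : ℂ :=
  1 / (2 * Real.pi) * Complex.exp (2 * t * z) *
    (Complex.Gamma (lam + Complex.I * z) * Complex.Gamma (lam - Complex.I * z))

theorem mpKernel_ofReal (lam t x : ℝ) : mpKernel lam t x = (mpWeight lam t x : ℂ) := by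
  have h : (lam - Complex.I * x : ℂ) = (starRingEnd ℂ) (lam + Complex.I * x) := by
    simp [sub_eq_add_neg]
  rw [mpKernel, mpWeight, h, Complex.Gamma_conj, Complex.mul_conj, Complex.normSq_eq_norm_sq]
  push_cast
  rfl

theorem exists_norm_eval_mul_mpKernel_le {lam t d : ℝ} (hd : d < lam)
    (ht : |t| < Real.pi / 2) (p : ℂ[X]) :
    ∃ ε K : ℝ, 0 < ε ∧ ∀ x v : ℝ, |v| ≤ d →
      ‖p.eval (x + v * Complex.I) * mpKernel lam t (x + v * Complex.I)‖ ≤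
        K * Real.exp (-ε * |x|) := by
  obtain ⟨θ, htθ, hθ⟩ := exists_between ht
  obtain ⟨K₁, hK₁, h₁⟩ := exists_norm_eval_le_exp p (sub_pos.2 htθ)
  obtain ⟨K₂, hK₂, h₂⟩ := exists_norm_Gamma_le_exp (a := lam - d) (b := lam + d)
    (sub_pos.2 hd) hθ
  -- The rates add up: `θ - |t|` from the polynomial, `2|t|` from the exponential and `-2θ` from the
  -- two Gamma factors, in total `-(θ - |t|)`.
  refine ⟨θ - |t|, (K₁ * Real.exp ((θ - |t|) * d)) * (1 / (2 * Real.pi) * (K₂ * K₂)),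
    sub_pos.2 htθ, fun x v hv => ?_⟩
  have hv' := abs_le.1 hv
  have e1 : (lam + Complex.I * (x + v * Complex.I) : ℂ) = ((lam - v : ℝ) : ℂ) + x * Complex.I := by
    push_cast
    linear_combination (v : ℂ) * Complex.I_sq
  have e2 : (lam - Complex.I * (x + v * Complex.I) : ℂ) =
      ((lam + v : ℝ) : ℂ) + (-x : ℝ) * Complex.I := by
    push_cast
    linear_combination (-v : ℂ) * Complex.I_sq
  have b1 := h₂ (lam - v) ⟨by linarith, by linarith⟩ x
  have b2 := h₂ (lam + v) ⟨by linarith, by linarith⟩ (-x)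
  rw [abs_neg] at b2
  have b3 : ‖Complex.exp (2 * t * (x + v * Complex.I))‖ ≤ Real.exp (2 * (|t| * |x|)) := by
    rw [Complex.norm_exp, ← abs_mul]
    have : (2 * (t : ℂ) * (x + v * Complex.I)).re = 2 * (t * x) := by simp [mul_assoc]
    rw [this]
    gcongr
    exact le_abs_self _
  have b4 : ‖p.eval (x + v * Complex.I)‖ ≤
      K₁ * Real.exp ((θ - |t|) * d) * Real.exp ((θ - |t|) * |x|) := by
    refine (h₁ _).trans ?_
    rw [mul_assoc, ← Real.exp_add, ← mul_add]
    have : ‖(x + v * Complex.I : ℂ)‖ ≤ d + |x| := by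
      refine (norm_add_le _ _).trans ?_
      simp only [norm_mul, Complex.norm_real, Complex.norm_I, mul_one, Real.norm_eq_abs]
      linarith
    have := sub_pos.2 htθ
    gcongr
  have hpi : ‖(1 / (2 * Real.pi) : ℂ)‖ = 1 / (2 * Real.pi) := by
    simp [abs_of_pos Real.pi_pos]
  rw [mpKernel, e1, e2, norm_mul, norm_mul, norm_mul, norm_mul, hpi]
  calc _ ≤ (K₁ * Real.exp ((θ - |t|) * d) * Real.exp ((θ - |t|) * |x|)) *
        (1 / (2 * Real.pi) * Real.exp (2 * (|t| * |x|)) *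
          ((K₂ * Real.exp (-θ * |x|)) * (K₂ * Real.exp (-θ * |x|)))) := by
        have := Real.pi_pos
        gcongr
    _ = (K₁ * Real.exp ((θ - |t|) * d)) * (1 / (2 * Real.pi) * (K₂ * K₂)) *
        (Real.exp ((θ - |t|) * |x|) * Real.exp (2 * (|t| * |x|)) *
          (Real.exp (-θ * |x|) * Real.exp (-θ * |x|))) := by ring
    _ = _ := by
        rw [← Real.exp_add, ← Real.exp_add, ← Real.exp_add]
        ring_nf

theorem differentiableAt_mpKernel {lam : ℝ} (t : ℝ) {z : ℂ} (hz : |z.im| < lam) :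
    DifferentiableAt ℂ (mpKernel lam t) z := by
  have hG : ∀ w : ℂ, 0 < w.re → DifferentiableAt ℂ Complex.Gamma w := fun w hw =>
    Complex.differentiableAt_Gamma _ fun m h => by
      rw [h] at hw
      simp at hw
      linarith [Nat.cast_nonneg (α := ℝ) m]
  have hz' := abs_lt.1 hz
  unfold mpKernel
  refine DifferentiableAt.mul (by fun_prop) (DifferentiableAt.mul ?_ ?_)
  · exact (hG (lam + Complex.I * z) (by simp; linarith)).comp z
      (f := fun z : ℂ => lam + Complex.I * z) (by fun_prop)
  · exact (hG (lam - Complex.I * z) (by simp; linarith)).comp z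
      (f := fun z : ℂ => lam - Complex.I * z) (by fun_prop)

theorem integrable_eval_mul_mpKernel_line {lam t v : ℝ} (hv : |v| < lam)
    (ht : |t| < Real.pi / 2) (p : ℂ[X]) :
    Integrable fun x : ℝ => p.eval (x + v * Complex.I) * mpKernel lam t (x + v * Complex.I) := by
  obtain ⟨ε, K, hε, h⟩ := exists_norm_eval_mul_mpKernel_le hv ht p
  refine ((integrable_exp_neg_mul_abs hε).const_mul K).mono' ?_ (ae_of_all _ fun x => h x v le_rfl)
  refine Continuous.aestronglyMeasurable (continuous_iff_continuousAt.2 fun x => ?_)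
  have hl : ContinuousAt (fun x : ℝ => (x + v * Complex.I : ℂ)) x := by fun_prop
  have hk := (differentiableAt_mpKernel t (z := x + v * Complex.I) (by simpa using hv)).continuousAt
  exact (ContinuousAt.comp (f := fun x : ℝ => (x + v * Complex.I : ℂ)) p.continuous.continuousAt
    hl).mul (ContinuousAt.comp (f := fun x : ℝ => (x + v * Complex.I : ℂ)) hk hl)

theorem integral_eval_mul_mpKernel_shift {lam t c : ℝ} (hc : |c| < lam)
    (ht : |t| < Real.pi / 2) (p : ℂ[X]) :
    ∫ x : ℝ, p.eval (x + c * Complex.I) * mpKernel lam t (x + c * Complex.I) =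
      ∫ x : ℝ, p.eval (x : ℂ) * mpKernel lam t x := by
  obtain ⟨ε, K, hε, h⟩ := exists_norm_eval_mul_mpKernel_le hc ht p
  have habs : ∀ v ∈ Set.uIcc 0 c, |v| ≤ |c| := fun v hv => by
    simpa using Set.abs_sub_left_of_mem_uIcc hv
  have h0 := integrable_eval_mul_mpKernel_line (v := 0) (by simpa using (abs_nonneg c).trans_lt hc)
    ht p
  simp only [Complex.ofReal_zero, zero_mul, add_zero] at h0
  exact integral_horizontal_shift (f := fun z => p.eval z * mpKernel lam t z) hε
    (fun z hz => (p.differentiable.differentiableAt.mul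
      (differentiableAt_mpKernel t ((habs _ hz).trans_lt hc))).differentiableWithinAt)
    (fun x v hv => h x v (habs v hv)) h0 (integrable_eval_mul_mpKernel_line hc ht p)

/-! ### The integration functional and its behaviour under half-unit shifts. -/

/-- Integration of complex polynomials against the Meixner-Pollaczek weight. -/
noncomputable def mpIntegral (lam t : ℝ) (p : ℂ[X]) : ℂ :=
  ∫ x : ℝ, p.eval (x : ℂ) * (mpWeight lam t x : ℂ)

theorem integrable_eval_mul_mpWeight {lam t : ℝ} (hlam : 0 < lam) (ht : |t| < Real.pi / 2)
    (p : ℂ[X]) : Integrable fun x : ℝ => p.eval (x : ℂ) * (mpWeight lam t x : ℂ) := by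
  simpa [mpKernel_ofReal] using
    integrable_eval_mul_mpKernel_line (v := 0) (by simpa using hlam) ht p

theorem mpIntegral_add {lam t : ℝ} (hlam : 0 < lam) (ht : |t| < Real.pi / 2) (p q : ℂ[X]) :
    mpIntegral lam t (p + q) = mpIntegral lam t p + mpIntegral lam t q := by
  simp only [mpIntegral, eval_add, add_mul]
  exact integral_add (integrable_eval_mul_mpWeight hlam ht p)
    (integrable_eval_mul_mpWeight hlam ht q)

theorem mpIntegral_C_mul (lam t : ℝ) (a : ℂ) (p : ℂ[X]) :
    mpIntegral lam t (C a * p) = a * mpIntegral lam t p := by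
  simp only [mpIntegral, eval_mul, eval_C, mul_assoc]
  exact integral_const_mul _ _

theorem mpIntegral_sub {lam t : ℝ} (hlam : 0 < lam) (ht : |t| < Real.pi / 2) (p q : ℂ[X]) :
    mpIntegral lam t (p - q) = mpIntegral lam t p - mpIntegral lam t q := by
  have h := mpIntegral_add hlam ht p (C (-1) * q)
  rw [mpIntegral_C_mul] at h
  rw [sub_eq_add_neg, sub_eq_add_neg, show -q = C (-1) * q by simp, h]
  ring

/-- The shift cancels the extra `1/2` in one Gamma argument and raises the other by `1`; the
functional equation leaves a linear factor. -/
theorem mpKernel_add_half_shift_up {lam : ℝ} (hlam : 0 < lam) (t x : ℝ) :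
    mpKernel (lam + 1 / 2) t (x + (1 / 2 : ℝ) * Complex.I) =
      Complex.exp (t * Complex.I) * (lam - Complex.I * x) * mpKernel lam t x := by
  have hne : (lam - Complex.I * x : ℂ) ≠ 0 := fun h => by
    have := congrArg Complex.re h
    simp at this
    exact hlam.ne' this
  have e1 : (((lam + 1 / 2 : ℝ) : ℂ) + Complex.I * (x + (1 / 2 : ℝ) * Complex.I)) =
      lam + Complex.I * x := by
    push_cast
    linear_combination (1 / 2 : ℂ) * Complex.I_sq
  have e2 : (((lam + 1 / 2 : ℝ) : ℂ) - Complex.I * (x + (1 / 2 : ℝ) * Complex.I)) =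
      lam - Complex.I * x + 1 := by
    push_cast
    linear_combination (-1 / 2 : ℂ) * Complex.I_sq
  have e3 : (2 * t * (x + (1 / 2 : ℝ) * Complex.I) : ℂ) = t * Complex.I + 2 * t * x := by
    push_cast
    ring
  rw [mpKernel, mpKernel, e1, e2, e3, Complex.Gamma_add_one _ hne, Complex.exp_add]
  ring

theorem mpKernel_add_half_shift_down {lam : ℝ} (hlam : 0 < lam) (t x : ℝ) :
    mpKernel (lam + 1 / 2) t (x + (-(1 / 2) : ℝ) * Complex.I) =
      Complex.exp (-t * Complex.I) * (lam + Complex.I * x) * mpKernel lam t x := by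
  have hne : (lam + Complex.I * x : ℂ) ≠ 0 := fun h => by
    have := congrArg Complex.re h
    simp at this
    exact hlam.ne' this
  have e1 : (((lam + 1 / 2 : ℝ) : ℂ) + Complex.I * (x + (-(1 / 2) : ℝ) * Complex.I)) =
      lam + Complex.I * x + 1 := by
    push_cast
    linear_combination (-1 / 2 : ℂ) * Complex.I_sq
  have e2 : (((lam + 1 / 2 : ℝ) : ℂ) - Complex.I * (x + (-(1 / 2) : ℝ) * Complex.I)) =
      lam - Complex.I * x := by
    push_cast
    linear_combination (1 / 2 : ℂ) * Complex.I_sq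
  have e3 : (2 * t * (x + (-(1 / 2) : ℝ) * Complex.I) : ℂ) = -t * Complex.I + 2 * t * x := by
    push_cast
    ring
  rw [mpKernel, mpKernel, e1, e2, e3, Complex.Gamma_add_one _ hne, Complex.exp_add]
  ring

/-- The continued weight for `lam + 1/2` is holomorphic on `|Im z| < lam + 1/2`, so a shift by `1/2`
crosses no pole. -/
theorem mpIntegral_shift_up {lam t : ℝ} (hlam : 0 < lam) (ht : |t| < Real.pi / 2) (q : ℂ[X]) :
    mpIntegral (lam + 1 / 2) t q = Complex.exp (t * Complex.I) *
      mpIntegral lam t ((C (lam : ℂ) - C Complex.I * X) * taylor (Complex.I / 2) q) := by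
  have h := integral_eval_mul_mpKernel_shift (lam := lam + 1 / 2) (c := 1 / 2)
    (by rw [abs_of_pos] <;> linarith) ht q
  simp only [mpKernel_add_half_shift_up hlam, mpKernel_ofReal] at h
  rw [mpIntegral, ← h, mpIntegral, ← integral_const_mul]
  congr 1 with x
  rw [eval_mul, taylor_eval]
  simp only [eval_sub, eval_C, eval_mul, eval_X]
  rw [show (x : ℂ) + ((1 / 2 : ℝ) : ℂ) * Complex.I = x + Complex.I / 2 by push_cast; ring]
  ring

theorem mpIntegral_shift_down {lam t : ℝ} (hlam : 0 < lam) (ht : |t| < Real.pi / 2) (q : ℂ[X]) :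
    mpIntegral (lam + 1 / 2) t q = Complex.exp (-t * Complex.I) *
      mpIntegral lam t ((C (lam : ℂ) + C Complex.I * X) * taylor (-(Complex.I / 2)) q) := by
  have h := integral_eval_mul_mpKernel_shift (lam := lam + 1 / 2) (c := -(1 / 2))
    (by rw [abs_neg, abs_of_pos] <;> linarith) ht q
  simp only [mpKernel_add_half_shift_down hlam, mpKernel_ofReal] at h
  rw [mpIntegral, ← h, mpIntegral, ← integral_const_mul]
  congr 1 with x
  rw [eval_mul, taylor_eval]
  simp only [eval_add, eval_C, eval_mul, eval_X]
  rw [show (x : ℂ) + ((-(1 / 2) : ℝ) : ℂ) * Complex.I = x + -(Complex.I / 2) by push_cast; ring]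
  ring

theorem mpWeight_pos {lam : ℝ} (hlam : 0 < lam) (t x : ℝ) : 0 < mpWeight lam t x := by
  have : Complex.Gamma ((lam : ℂ) + Complex.I * (x : ℂ)) ≠ 0 :=
    Complex.Gamma_ne_zero_of_re_pos (by simpa using hlam)
  have := norm_pos_iff.2 this
  have := Real.pi_pos
  unfold mpWeight
  positivity

theorem mpIntegral_map (lam t : ℝ) (p : ℝ[X]) :
    mpIntegral lam t (p.map Complex.ofRealHom) =
      ((∫ x : ℝ, p.eval x * mpWeight lam t x : ℝ) : ℂ) := by
  rw [mpIntegral, ← integral_complex_ofReal]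
  congr 1 with x
  have : (p.map Complex.ofRealHom).eval (x : ℂ) = ((p.eval x : ℝ) : ℂ) :=
    eval_map_apply (f := Complex.ofRealHom) (p := p) x
  rw [this, Complex.ofReal_mul]

theorem mpIntegral_one_ne_zero {lam t : ℝ} (hlam : 0 < lam) (ht : |t| < Real.pi / 2) :
    mpIntegral lam t 1 ≠ 0 := by
  have h := integrable_eval_mul_mpWeight hlam ht 1
  simp only [eval_one, one_mul] at h
  rw [← Polynomial.map_one Complex.ofRealHom, mpIntegral_map]
  simp only [eval_one, one_mul]
  refine Complex.ofReal_ne_zero.2 (ne_of_gt ?_)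
  rw [integral_pos_iff_support_of_nonneg (fun x => (mpWeight_pos hlam t x).le)
    (by simpa using h.re)]
  have : Function.support (fun x => mpWeight lam t x) = Set.univ :=
    Set.eq_univ_of_forall fun x => (mpWeight_pos hlam t x).ne'
  simp [this]

/-! ### The raising operator, its adjoint and their leading coefficients. -/

theorem coeff_taylor_of_natDegree_le {R : Type*} [CommRing R] {q : R[X]} {n : ℕ}
    (h : q.natDegree ≤ n) (c : R) : (taylor c q).coeff n = q.coeff n := by
  rcases h.eq_or_lt with rfl | h
  · exact coeff_taylor_natDegree ..
  · rw [coeff_eq_zero_of_natDegree_lt h,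
      coeff_eq_zero_of_natDegree_lt (by rwa [natDegree_taylor])]

theorem coeff_taylor_of_natDegree_le_succ {R : Type*} [CommRing R] {q : R[X]} {n : ℕ}
    (h : q.natDegree ≤ n + 1) (c : R) :
    (taylor c q).coeff n = q.coeff n + (n + 1) * c * q.coeff (n + 1) := by
  have hd : (hasseDeriv n q).natDegree ≤ 1 := (natDegree_hasseDeriv_le q n).trans (by omega)
  rw [taylor_coeff, eq_X_add_C_of_natDegree_le_one hd]
  simp only [eval_add, eval_mul, eval_C, eval_X, hasseDeriv_coeff, zero_add, Nat.choose_self,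
    add_comm 1 n, Nat.choose_succ_self_right]
  push_cast
  ring

/-- The raising operator for the weight with parameter `t`. -/
noncomputable def mpRaise (lam t : ℝ) (q : ℂ[X]) : ℂ[X] :=
  C (Complex.I / (2 * Real.cos t : ℝ)) *
    (C (Complex.exp (t * Complex.I)) *
        ((C (lam : ℂ) - C Complex.I * X) * taylor (Complex.I / 2) q) -
      C (Complex.exp (-t * Complex.I)) *
        ((C (lam : ℂ) + C Complex.I * X) * taylor (-(Complex.I / 2)) q))

/-- The adjoint of `mpRaise lam t` with respect to the weights with parameter `s`. -/
noncomputable def mpLower (t s : ℝ) (r : ℂ[X]) : ℂ[X] :=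
  C (Complex.I / (2 * Real.cos t : ℝ)) *
    (C (Complex.exp ((t - s : ℝ) * Complex.I)) * taylor (-(Complex.I / 2)) r -
      C (Complex.exp (-(t - s : ℝ) * Complex.I)) * taylor (Complex.I / 2) r)

/-- Each half of the raising operator is one side of a shift identity once `r` is translated the
opposite way; the phases `e^{±it}` and `e^{∓is}` combine to `e^{±i(t-s)}`. -/
theorem mpIntegral_mpRaise_mul {lam s : ℝ} (hlam : 0 < lam) (hs : |s| < Real.pi / 2) (t : ℝ)
    (q r : ℂ[X]) :
    mpIntegral lam s (mpRaise lam t q * r) =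
      mpIntegral (lam + 1 / 2) s (q * mpLower t s r) := by
  have h1 := mpIntegral_shift_up hlam hs (q * taylor (-(Complex.I / 2)) r)
  have h2 := mpIntegral_shift_down hlam hs (q * taylor (Complex.I / 2) r)
  simp only [taylor_mul, taylor_taylor, add_neg_cancel, neg_add_cancel, taylor_zero] at h1 h2
  have e1 : mpRaise lam t q * r = C (Complex.I / (2 * Real.cos t : ℝ)) *
      (C (Complex.exp (t * Complex.I)) *
        ((C (lam : ℂ) - C Complex.I * X) * (taylor (Complex.I / 2) q * r)) -
      C (Complex.exp (-t * Complex.I)) *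
        ((C (lam : ℂ) + C Complex.I * X) * (taylor (-(Complex.I / 2)) q * r))) := by
    rw [mpRaise]; ring
  have e2 : q * mpLower t s r = C (Complex.I / (2 * Real.cos t : ℝ)) *
      (C (Complex.exp ((t - s : ℝ) * Complex.I)) * (q * taylor (-(Complex.I / 2)) r) -
      C (Complex.exp (-(t - s : ℝ) * Complex.I)) * (q * taylor (Complex.I / 2) r)) := by
    rw [mpLower]; ring
  rw [e1, e2, mpIntegral_C_mul, mpIntegral_C_mul, mpIntegral_sub hlam hs,
    mpIntegral_sub (by linarith) hs, mpIntegral_C_mul, mpIntegral_C_mul, mpIntegral_C_mul,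
    mpIntegral_C_mul, h1, h2, ← mul_assoc (Complex.exp _), ← mul_assoc (Complex.exp _),
    ← Complex.exp_add, ← Complex.exp_add]
  congr 4 <;> push_cast <;> ring

theorem exp_mul_I_sub_exp_neg (θ : ℝ) :
    Complex.exp (θ * Complex.I) - Complex.exp (-θ * Complex.I) =
      2 * Complex.I * (Real.sin θ : ℝ) := by
  rw [Complex.exp_mul_I, Complex.exp_mul_I, Complex.cos_neg, Complex.sin_neg, Complex.ofReal_sin]
  ring

theorem exp_mul_I_add_exp_neg (θ : ℝ) :
    Complex.exp (θ * Complex.I) + Complex.exp (-θ * Complex.I) = 2 * (Real.cos θ : ℝ) := by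
  rw [Complex.exp_mul_I, Complex.exp_mul_I, Complex.cos_neg, Complex.sin_neg, Complex.ofReal_cos]
  ring

theorem natDegree_mpRaise_le (lam t : ℝ) {q : ℂ[X]} {n : ℕ} (h : q.natDegree ≤ n) :
    (mpRaise lam t q).natDegree ≤ n + 1 := by
  have h' (c : ℂ) : (taylor c q).natDegree ≤ n := by rwa [natDegree_taylor]
  have l1 : (C (lam : ℂ) - C Complex.I * X).natDegree ≤ 1 := by compute_degree
  have l2 : (C (lam : ℂ) + C Complex.I * X).natDegree ≤ 1 := by compute_degree
  rw [add_comm n 1]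
  exact (natDegree_C_mul_le _ _).trans ((natDegree_sub_le_of_le
    ((natDegree_C_mul_le _ _).trans (natDegree_mul_le_of_le l1 (h' _)))
    ((natDegree_C_mul_le _ _).trans (natDegree_mul_le_of_le l2 (h' _)))).trans (max_self _).le)

theorem coeff_mpRaise_succ (lam : ℝ) {t : ℝ} (ht : Real.cos t ≠ 0) {q : ℂ[X]} {n : ℕ}
    (h : q.natDegree ≤ n) : (mpRaise lam t q).coeff (n + 1) = q.coeff n := by
  have hz (c : ℂ) : (taylor c q).coeff (n + 1) = 0 :=
    coeff_eq_zero_of_natDegree_lt (by rw [natDegree_taylor]; omega)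
  simp only [mpRaise, coeff_C_mul, coeff_sub, sub_mul, add_mul, coeff_add, mul_assoc, coeff_X_mul,
    hz, coeff_taylor_of_natDegree_le h]
  have hc : ((Real.cos t : ℝ) : ℂ) ≠ 0 := Complex.ofReal_ne_zero.2 ht
  have := exp_mul_I_add_exp_neg t
  rw [Complex.ofReal_mul, Complex.ofReal_ofNat]
  generalize Complex.exp (t * Complex.I) = u at *
  generalize Complex.exp (-t * Complex.I) = v at *
  field_simp
  linear_combination (-q.coeff n * Complex.I ^ 2) * this +
    (-2 * (Real.cos t : ℂ) * q.coeff n) * Complex.I_sq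

/-- Together with `coeff_mpRaise_succ` this tracks the two highest coefficients. Multiplying by `X`
encodes the coefficient of index `n - 1` uniformly, including `n = 0`. -/
theorem coeff_mpRaise (lam : ℝ) {t : ℝ} (ht : Real.cos t ≠ 0) {q : ℂ[X]} {n : ℕ}
    (h : q.natDegree ≤ n) : (mpRaise lam t q).coeff n =
      (X * q).coeff n - (2 * lam + n) / 2 * Real.tan t * q.coeff n := by
  have hX (c : ℂ) : (X * taylor c q).coeff n = (X * q).coeff n + n * c * q.coeff n := by
    cases n with
    | zero => simp
    | succ n =>
      rw [coeff_X_mul, coeff_X_mul, coeff_taylor_of_natDegree_le_succ h]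
      push_cast
      ring
  simp only [mpRaise, coeff_C_mul, coeff_sub, sub_mul, add_mul, coeff_add, mul_assoc,
    hX, coeff_taylor_of_natDegree_le h]
  have hc : ((Real.cos t : ℝ) : ℂ) ≠ 0 := Complex.ofReal_ne_zero.2 ht
  have h1 := exp_mul_I_add_exp_neg t
  have h2 := exp_mul_I_sub_exp_neg t
  rw [Complex.ofReal_mul, Complex.ofReal_ofNat, Real.tan_eq_sin_div_cos, Complex.ofReal_div]
  generalize Complex.exp (t * Complex.I) = u at *
  generalize Complex.exp (-t * Complex.I) = v at *
  field_simp
  linear_combination (-2 * (X * q).coeff n * Complex.I ^ 2) * h1 +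
    (2 * Complex.I * lam * q.coeff n - n * q.coeff n * Complex.I ^ 3) * h2 +
    (-4 * (Real.cos t : ℂ) * (X * q).coeff n + 4 * lam * q.coeff n * (Real.sin t : ℂ) +
      2 * n * q.coeff n * (Real.sin t : ℂ) * (1 - Complex.I ^ 2)) * Complex.I_sq

theorem natDegree_mpLower_le (t s : ℝ) {r : ℂ[X]} {n : ℕ} (h : r.natDegree ≤ n) :
    (mpLower t s r).natDegree ≤ n := by
  have h' (c : ℂ) : (taylor c r).natDegree ≤ n := by rwa [natDegree_taylor]
  exact (natDegree_C_mul_le _ _).trans ((natDegree_sub_le_of_le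
    ((natDegree_C_mul_le _ _).trans (h' _))
    ((natDegree_C_mul_le _ _).trans (h' _))).trans (max_self _).le)

theorem coeff_mpLower (t s : ℝ) {r : ℂ[X]} {n : ℕ} (h : r.natDegree ≤ n) :
    (mpLower t s r).coeff n = (Real.sin (s - t) / Real.cos t : ℝ) * r.coeff n := by
  simp only [mpLower, coeff_C_mul, coeff_sub, coeff_taylor_of_natDegree_le h]
  rw [← sub_mul, exp_mul_I_sub_exp_neg, ← neg_sub t s, Real.sin_neg]
  -- Both sides vanish when `cos t = 0`, because division by zero gives zero.
  by_cases hc : Real.cos t = 0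
  · simp [hc]
  have hc : ((Real.cos t : ℝ) : ℂ) ≠ 0 := Complex.ofReal_ne_zero.2 hc
  rw [Complex.ofReal_mul, Complex.ofReal_ofNat, Complex.ofReal_div, Complex.ofReal_neg]
  field_simp
  linear_combination (Real.sin (t - s) * r.coeff n : ℂ) * Complex.I_sq

/-- For equal parameters the phases are `1`, so the highest terms of the two translates cancel and
only the linear Taylor terms remain. -/
theorem coeff_mpLower_self (t : ℝ) {r : ℂ[X]} {n : ℕ} (h : r.natDegree ≤ n + 1) :
    (mpLower t t r).coeff n = ((n + 1) / (2 * Real.cos t) : ℝ) * r.coeff (n + 1) := by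
  simp only [mpLower, coeff_C_mul, coeff_sub, coeff_taylor_of_natDegree_le_succ h, sub_self,
    Complex.ofReal_zero, neg_zero, zero_mul, Complex.exp_zero, one_mul]
  push_cast
  linear_combination (-(n + 1) * r.coeff (n + 1) / (2 * Complex.cos t)) * Complex.I_sq

theorem degree_mpLower_self_lt (t : ℝ) {r : ℂ[X]} {n : ℕ} (h : r.degree < (n + 1 : ℕ)) :
    (mpLower t t r).degree < n := by
  rw [degree_lt_iff_coeff_zero] at h ⊢
  intro m hm
  rw [coeff_mpLower_self t (natDegree_le_iff_coeff_eq_zero.2 fun j hj => h j (by omega)),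
    h (m + 1) (by omega), mul_zero]

/-! ### Orthogonality and moments under raising. -/

/-- `Q` is orthogonal to all polynomials of degree less than `n`. -/
def MPOrtho (lam t : ℝ) (n : ℕ) (Q : ℂ[X]) : Prop :=
  ∀ r : ℂ[X], r.degree < n → mpIntegral lam t (Q * r) = 0

theorem MPOrtho.mono {lam t : ℝ} {m n : ℕ} {Q : ℂ[X]} (h : MPOrtho lam t n Q) (hm : m ≤ n) :
    MPOrtho lam t m Q :=
  fun r hr => h r (hr.trans_le (by exact_mod_cast hm))

theorem MPOrtho.zero (lam t : ℝ) (Q : ℂ[X]) : MPOrtho lam t 0 Q := fun r hr => by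
  have : r = 0 := by simpa [Nat.WithBot.lt_zero_iff] using hr
  simp [this, mpIntegral]

/-- The adjoint lowers the degree of test polynomials, so one order of orthogonality is gained. -/
theorem MPOrtho.mpRaise_self {lam t : ℝ} (hlam : 0 < lam) (ht : |t| < Real.pi / 2) {n : ℕ}
    {q : ℂ[X]} (h : MPOrtho (lam + 1 / 2) t n q) : MPOrtho lam t (n + 1) (mpRaise lam t q) :=
  fun r hr => by
    rw [mpIntegral_mpRaise_mul hlam ht]
    exact h _ (degree_mpLower_self_lt t hr)

/-- For another weight the adjoint does not increase degrees, so orthogonality already present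
survives. -/
theorem MPOrtho.mpRaise {lam s : ℝ} (hlam : 0 < lam) (hs : |s| < Real.pi / 2) (t : ℝ) {n : ℕ}
    {q : ℂ[X]} (h : MPOrtho (lam + 1 / 2) s n q) : MPOrtho lam s n (mpRaise lam t q) := by
  cases n with
  | zero => exact MPOrtho.zero lam s _
  | succ n =>
    intro r hr
    rw [mpIntegral_mpRaise_mul hlam hs]
    refine h _ (degree_lt_iff_coeff_zero _ _ |>.2 fun m hm => ?_)
    refine coeff_eq_zero_of_natDegree_lt ((natDegree_mpLower_le t s (n := n) ?_).trans_lt hm)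
    exact natDegree_le_iff_coeff_eq_zero.2 fun j hj =>
      (degree_lt_iff_coeff_zero _ _).1 hr j hj

/-- Lower terms of `r` integrate to zero against `Q`, so only its top coefficient matters. -/
theorem MPOrtho.mpIntegral_mul {lam t : ℝ} (hlam : 0 < lam) (ht : |t| < Real.pi / 2) {n : ℕ}
    {Q r : ℂ[X]} (h : MPOrtho lam t n Q) (hr : r.natDegree ≤ n) :
    mpIntegral lam t (Q * r) = r.coeff n * mpIntegral lam t (Q * X ^ n) := by
  have h1 := h (r - C (r.coeff n) * X ^ n) (by
    refine (degree_lt_iff_coeff_zero _ _).2 fun m hm => ?_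
    rw [coeff_sub, coeff_C_mul_X_pow]
    rcases hm.eq_or_lt with rfl | hm
    · simp
    · rw [if_neg hm.ne', coeff_eq_zero_of_natDegree_lt (hr.trans_lt hm), sub_zero])
  rw [mul_sub, mpIntegral_sub hlam ht, sub_eq_zero,
    show Q * (C (r.coeff n) * X ^ n) = C (r.coeff n) * (Q * X ^ n) by ring,
    mpIntegral_C_mul] at h1
  exact h1

theorem MPOrtho.mpIntegral_mpRaise_self {lam t : ℝ} (hlam : 0 < lam) (ht : |t| < Real.pi / 2)
    {n : ℕ} {q : ℂ[X]} (h : MPOrtho (lam + 1 / 2) t n q) :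
    mpIntegral lam t (_root_.mpRaise lam t q * X ^ (n + 1)) =
      ((n + 1) / (2 * Real.cos t) : ℝ) * mpIntegral (lam + 1 / 2) t (q * X ^ n) := by
  have hlow : (mpLower t t ((X : ℂ[X]) ^ (n + 1))).natDegree ≤ n := by
    refine natDegree_le_iff_coeff_eq_zero.2 fun m hm => ?_
    rw [coeff_mpLower_self t (natDegree_X_pow_le _ |>.trans (by omega)), coeff_X_pow,
      if_neg (by omega), mul_zero]
  rw [mpIntegral_mpRaise_mul hlam ht, h.mpIntegral_mul (by linarith) ht hlow,
    coeff_mpLower_self t (natDegree_X_pow_le _), coeff_X_pow, if_pos rfl, mul_one]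

theorem MPOrtho.mpIntegral_mpRaise {lam s : ℝ} (hlam : 0 < lam) (hs : |s| < Real.pi / 2) (t : ℝ)
    {n : ℕ} {q : ℂ[X]} (h : MPOrtho (lam + 1 / 2) s n q) :
    mpIntegral lam s (_root_.mpRaise lam t q * X ^ n) =
      (Real.sin (s - t) / Real.cos t : ℝ) * mpIntegral (lam + 1 / 2) s (q * X ^ n) := by
  rw [mpIntegral_mpRaise_mul hlam hs, h.mpIntegral_mul (by linarith) hs
    (natDegree_mpLower_le _ _ (natDegree_X_pow_le _)), coeff_mpLower _ _ (natDegree_X_pow_le _),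
    coeff_X_pow, if_pos rfl, mul_one]

/-- Taking `q = 1` in both shift identities and eliminating the first moment leaves a relation
between total masses. -/
theorem mpIntegral_one_add_half {lam t : ℝ} (hlam : 0 < lam) (ht : |t| < Real.pi / 2)
    (hc : Real.cos t ≠ 0) :
    mpIntegral (lam + 1 / 2) t 1 = (lam / Real.cos t : ℝ) * mpIntegral lam t 1 := by
  have h1 := mpIntegral_shift_up hlam ht 1
  have h2 := mpIntegral_shift_down hlam ht 1
  rw [taylor_one, C_1, mul_one, mpIntegral_sub hlam ht, mpIntegral_C_mul,
    ← mul_one (C (lam : ℂ)), mpIntegral_C_mul] at h1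
  rw [taylor_one, C_1, mul_one, mpIntegral_add hlam ht, mpIntegral_C_mul,
    ← mul_one (C (lam : ℂ)), mpIntegral_C_mul] at h2
  have hc' : ((Real.cos t : ℝ) : ℂ) ≠ 0 := Complex.ofReal_ne_zero.2 hc
  have h3 := exp_mul_I_add_exp_neg t
  have h4 : Complex.exp (t * Complex.I) * Complex.exp (-t * Complex.I) = 1 := by
    rw [← Complex.exp_add]; simp
  rw [Complex.ofReal_div, div_mul_eq_mul_div, eq_div_iff hc']
  linear_combination (Complex.exp (-t * Complex.I) / 2) * h1 +
    (Complex.exp (t * Complex.I) / 2) * h2 - (mpIntegral (lam + 1 / 2) t 1 / 2) * h3 +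
    (lam * mpIntegral lam t 1) * h4

/-- Conjugation swaps the two terms and changes the sign of the prefactor. Hence raising preserves
real coefficients. -/
theorem map_conj_mpRaise (lam t : ℝ) (q : ℂ[X]) :
    (mpRaise lam t q).map (starRingEnd ℂ) = mpRaise lam t (q.map (starRingEnd ℂ)) := by
  have e1 : (starRingEnd ℂ) (Complex.exp (t * Complex.I)) = Complex.exp (-t * Complex.I) := by
    rw [← Complex.exp_conj]; simp
  have e2 : (starRingEnd ℂ) (Complex.exp (-t * Complex.I)) = Complex.exp (t * Complex.I) := by
    rw [← Complex.exp_conj]; simp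
  have e3 : (starRingEnd ℂ) (Complex.I / 2) = -(Complex.I / 2) := by
    rw [map_div₀, Complex.conj_I, map_ofNat, neg_div]
  simp only [mpRaise, Polynomial.map_mul, Polynomial.map_sub, Polynomial.map_add, map_C, map_X,
    map_taylor, e1, e2, e3, map_neg, neg_neg, Complex.conj_ofReal, map_div₀, Complex.conj_I,
    neg_div]
  ring

/-! ### The polynomials: degree, top coefficients, orthogonality and moments. -/

/-- The multiple Meixner-Pollaczek polynomials as complex polynomials, built by repeated raising. -/
noncomputable def mpPoly (t₁ t₂ : ℝ) : ℕ → ℕ → ℝ → ℂ[X]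
  | 0, 0, _ => 1
  | 0, k₂ + 1, lam => mpRaise lam t₂ (mpPoly t₁ t₂ 0 k₂ (lam + 1 / 2))
  | k₁ + 1, k₂, lam => mpRaise lam t₁ (mpPoly t₁ t₂ k₁ k₂ (lam + 1 / 2))

theorem cos_pos_of_abs_lt {t : ℝ} (ht : |t| < Real.pi / 2) : 0 < Real.cos t :=
  Real.cos_pos_of_mem_Ioo (abs_lt.1 ht)

theorem natDegree_mpPoly_le (t₁ t₂ : ℝ) (k₁ k₂ : ℕ) (lam : ℝ) :
    (mpPoly t₁ t₂ k₁ k₂ lam).natDegree ≤ k₁ + k₂ := by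
  induction k₁ generalizing lam with
  | zero =>
    induction k₂ generalizing lam with
    | zero => simp [mpPoly]
    | succ k₂ ih => rw [mpPoly]; exact natDegree_mpRaise_le _ _ (ih _)
  | succ k₁ ih =>
    rw [mpPoly, add_right_comm]; exact natDegree_mpRaise_le _ _ (ih _)

theorem map_conj_mpPoly (t₁ t₂ : ℝ) (k₁ k₂ : ℕ) (lam : ℝ) :
    (mpPoly t₁ t₂ k₁ k₂ lam).map (starRingEnd ℂ) = mpPoly t₁ t₂ k₁ k₂ lam := by
  induction k₁ generalizing lam with
  | zero =>
    induction k₂ generalizing lam with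
    | zero => simp [mpPoly]
    | succ k₂ ih => rw [mpPoly, map_conj_mpRaise, ih]
  | succ k₁ ih => rw [mpPoly, map_conj_mpRaise, ih]

theorem coeff_mpPoly_top {t₁ t₂ : ℝ} (h₁ : |t₁| < Real.pi / 2) (h₂ : |t₂| < Real.pi / 2)
    (k₁ k₂ : ℕ) (lam : ℝ) :
    (mpPoly t₁ t₂ k₁ k₂ lam).coeff (k₁ + k₂) = 1 := by
  have c₁ := (cos_pos_of_abs_lt h₁).ne'
  have c₂ := (cos_pos_of_abs_lt h₂).ne'
  induction k₁ generalizing lam with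
  | zero =>
    induction k₂ generalizing lam with
    | zero => simp [mpPoly]
    | succ k₂ ih =>
      rw [mpPoly, ← add_assoc, coeff_mpRaise_succ _ c₂ (natDegree_mpPoly_le ..), ih]
  | succ k₁ ih =>
    rw [mpPoly, add_right_comm, coeff_mpRaise_succ _ c₁ (natDegree_mpPoly_le ..), ih]

/-- This is the subleading coefficient, accumulated from the `tan` terms of the successive raisings.
-/
theorem coeff_X_mul_mpPoly {t₁ t₂ : ℝ} (h₁ : |t₁| < Real.pi / 2) (h₂ : |t₂| < Real.pi / 2)
    (k₁ k₂ : ℕ) (lam : ℝ) :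
    (X * mpPoly t₁ t₂ k₁ k₂ lam).coeff (k₁ + k₂) =
      ((-((2 * lam + (k₁ + k₂) - 1) / 2 * (k₁ * Real.tan t₁ + k₂ * Real.tan t₂)) : ℝ) : ℂ) := by
  have c₁ := (cos_pos_of_abs_lt h₁).ne'
  have c₂ := (cos_pos_of_abs_lt h₂).ne'
  induction k₁ generalizing lam with
  | zero =>
    induction k₂ generalizing lam with
    | zero => simp
    | succ k₂ ih =>
      rw [mpPoly, ← add_assoc, coeff_X_mul, coeff_mpRaise _ c₂ (natDegree_mpPoly_le ..), ih,
        coeff_mpPoly_top h₁ h₂]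
      push_cast
      ring
  | succ k₁ ih =>
    rw [mpPoly, add_right_comm, coeff_X_mul, coeff_mpRaise _ c₁ (natDegree_mpPoly_le ..), ih,
      coeff_mpPoly_top h₁ h₂]
    push_cast
    ring

theorem mpOrtho_mpPoly {t₁ t₂ : ℝ} (h₁ : |t₁| < Real.pi / 2) (h₂ : |t₂| < Real.pi / 2)
    (k₁ k₂ : ℕ) {lam : ℝ} (hlam : 0 < lam) :
    MPOrtho lam t₁ k₁ (mpPoly t₁ t₂ k₁ k₂ lam) ∧ MPOrtho lam t₂ k₂ (mpPoly t₁ t₂ k₁ k₂ lam) := by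
  induction k₁ generalizing lam with
  | zero =>
    refine ⟨MPOrtho.zero _ _ _, ?_⟩
    induction k₂ generalizing lam with
    | zero => exact MPOrtho.zero _ _ _
    | succ k₂ ih => rw [mpPoly]; exact (ih (by linarith)).mpRaise_self hlam h₂
  | succ k₁ ih =>
    have := ih (lam := lam + 1 / 2) (by linarith)
    rw [mpPoly]
    exact ⟨this.1.mpRaise_self hlam h₁, this.2.mpRaise hlam h₂ _⟩

/-- Each raising with `t₁` contributes a derivative-like factor, each raising with `t₂` a sine
quotient, and each shifts `lam` by `1/2`; what remains is a total mass. -/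
theorem mpIntegral_mpPoly_mul_pow_fst {t₁ t₂ : ℝ} (h₁ : |t₁| < Real.pi / 2) (h₂ : |t₂| < Real.pi / 2)
    (k₁ k₂ : ℕ) {lam : ℝ} (hlam : 0 < lam) :
    mpIntegral lam t₁ (mpPoly t₁ t₂ k₁ k₂ lam * X ^ k₁) =
      (k₁.factorial / (2 * Real.cos t₁) ^ k₁ * (Real.sin (t₁ - t₂) / Real.cos t₂) ^ k₂ : ℝ) *
        mpIntegral (lam + (k₁ + k₂) / 2) t₁ 1 := by
  induction k₁ generalizing lam with
  | zero =>
    induction k₂ generalizing lam with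
    | zero => simp [mpPoly]
    | succ k₂ ih =>
      rw [mpPoly, (MPOrtho.zero (lam + 1 / 2) t₁ _).mpIntegral_mpRaise hlam h₁, ih (by linarith),
        show lam + 1 / 2 + ((0 : ℕ) + (k₂ : ℝ)) / 2 = lam + ((0 : ℕ) + ((k₂ + 1 : ℕ) : ℝ)) / 2 by
          push_cast; ring]
      push_cast
      ring
  | succ k₁ ih =>
    rw [mpPoly, (mpOrtho_mpPoly h₁ h₂ k₁ k₂ (by linarith)).1.mpIntegral_mpRaise_self hlam h₁,
      ih (by linarith),
      show lam + 1 / 2 + ((k₁ : ℝ) + k₂) / 2 = lam + (((k₁ + 1 : ℕ) : ℝ) + k₂) / 2 by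
        push_cast; ring, ← mul_assoc, ← Complex.ofReal_mul]
    congr 2
    rw [Nat.factorial_succ]
    have := (cos_pos_of_abs_lt h₁).ne'
    push_cast
    field_simp
    ring

theorem mpIntegral_mpPoly_mul_pow_snd {t₁ t₂ : ℝ} (h₁ : |t₁| < Real.pi / 2) (h₂ : |t₂| < Real.pi / 2)
    (k₁ k₂ : ℕ) {lam : ℝ} (hlam : 0 < lam) :
    mpIntegral lam t₂ (mpPoly t₁ t₂ k₁ k₂ lam * X ^ k₂) =
      (k₂.factorial / (2 * Real.cos t₂) ^ k₂ * (Real.sin (t₂ - t₁) / Real.cos t₁) ^ k₁ : ℝ) *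
        mpIntegral (lam + (k₁ + k₂) / 2) t₂ 1 := by
  induction k₁ generalizing lam with
  | zero =>
    induction k₂ generalizing lam with
    | zero => simp [mpPoly]
    | succ k₂ ih =>
      rw [mpPoly, (mpOrtho_mpPoly h₁ h₂ 0 k₂ (by linarith)).2.mpIntegral_mpRaise_self hlam h₂,
        ih (by linarith),
        show lam + 1 / 2 + ((0 : ℕ) + (k₂ : ℝ)) / 2 = lam + ((0 : ℕ) + ((k₂ + 1 : ℕ) : ℝ)) / 2 by
          push_cast; ring, ← mul_assoc, ← Complex.ofReal_mul]
      congr 2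
      rw [Nat.factorial_succ]
      have := (cos_pos_of_abs_lt h₂).ne'
      push_cast
      field_simp
      ring
  | succ k₁ ih =>
    rw [mpPoly, (mpOrtho_mpPoly h₁ h₂ k₁ k₂ (by linarith)).2.mpIntegral_mpRaise hlam h₂,
      ih (by linarith),
      show lam + 1 / 2 + ((k₁ : ℝ) + k₂) / 2 = lam + (((k₁ + 1 : ℕ) : ℝ) + k₂) / 2 by
        push_cast; ring]
    push_cast
    ring

theorem sin_sub_ne_zero {t₁ t₂ : ℝ} (h₁ : |t₁| < Real.pi / 2) (h₂ : |t₂| < Real.pi / 2)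
    (hne : t₁ ≠ t₂) : Real.sin (t₁ - t₂) ≠ 0 := by
  have h₁' := abs_lt.1 h₁
  have h₂' := abs_lt.1 h₂
  intro h
  have := (Real.sin_eq_zero_iff_of_lt_of_lt (by linarith) (by linarith)).1 h
  exact hne (sub_eq_zero.1 this)

theorem mpIntegral_mpPoly_mul_pow_ne_zero {t₁ t₂ : ℝ} (h₁ : |t₁| < Real.pi / 2) (h₂ : |t₂| < Real.pi / 2)
    (hne : t₁ ≠ t₂) (k₁ k₂ : ℕ) {lam : ℝ} (hlam : 0 < lam) :
    mpIntegral lam t₁ (mpPoly t₁ t₂ k₁ k₂ lam * X ^ k₁) ≠ 0 ∧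
      mpIntegral lam t₂ (mpPoly t₁ t₂ k₁ k₂ lam * X ^ k₂) ≠ 0 := by
  have c₁ := (cos_pos_of_abs_lt h₁).ne'
  have c₂ := (cos_pos_of_abs_lt h₂).ne'
  have s₁ := sin_sub_ne_zero h₁ h₂ hne
  have s₂ := sin_sub_ne_zero h₂ h₁ hne.symm
  rw [mpIntegral_mpPoly_mul_pow_fst h₁ h₂ k₁ k₂ hlam, mpIntegral_mpPoly_mul_pow_snd h₁ h₂ k₁ k₂ hlam]
  exact ⟨mul_ne_zero (Complex.ofReal_ne_zero.2 (by positivity))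
      (mpIntegral_one_ne_zero (by positivity) h₁),
    mul_ne_zero (Complex.ofReal_ne_zero.2 (by positivity))
      (mpIntegral_one_ne_zero (by positivity) h₂)⟩

/-! ### Normality. -/

theorem MPOrtho.sub {lam t : ℝ} (hlam : 0 < lam) (ht : |t| < Real.pi / 2) {n : ℕ} {P Q : ℂ[X]}
    (hP : MPOrtho lam t n P) (hQ : MPOrtho lam t n Q) : MPOrtho lam t n (P - Q) := fun r hr => by
  rw [sub_mul, mpIntegral_sub hlam ht, hP r hr, hQ r hr, sub_zero]

theorem MPOrtho.C_mul {lam t : ℝ} {n : ℕ} {P : ℂ[X]}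
    (hP : MPOrtho lam t n P) (a : ℂ) : MPOrtho lam t n (C a * P) := fun r hr => by
  rw [mul_assoc, mpIntegral_C_mul, hP r hr, mul_zero]

/-- Inductive step for normality, with normality of the same index as the hypothesis `hR`:
subtracting the right multiple of `mpPoly` lowers the degree. -/
theorem eq_C_mul_mpPoly_of_mpOrtho {t₁ t₂ : ℝ} (h₁ : |t₁| < Real.pi / 2)
    (h₂ : |t₂| < Real.pi / 2) {lam : ℝ} (hlam : 0 < lam) {k₁ k₂ : ℕ} {Q : ℂ[X]}
    (hd : Q.degree < (k₁ + k₂ + 1 : ℕ)) (o₁ : MPOrtho lam t₁ k₁ Q) (o₂ : MPOrtho lam t₂ k₂ Q)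
    (hR : ∀ R : ℂ[X], R.degree < (k₁ + k₂ : ℕ) → MPOrtho lam t₁ k₁ R → MPOrtho lam t₂ k₂ R →
      R = 0) : Q = C (Q.coeff (k₁ + k₂)) * mpPoly t₁ t₂ k₁ k₂ lam := by
  have o := mpOrtho_mpPoly h₁ h₂ k₁ k₂ hlam
  refine sub_eq_zero.1 (hR _ ?_ (o₁.sub hlam h₁ (o.1.C_mul _)) (o₂.sub hlam h₂ (o.2.C_mul _)))
  refine (degree_lt_iff_coeff_zero _ _).2 fun m hm => ?_
  rw [coeff_sub, coeff_C_mul]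
  rcases hm.eq_or_lt with rfl | hm
  · rw [coeff_mpPoly_top h₁ h₂, mul_one, sub_self]
  · rw [(degree_lt_iff_coeff_zero _ _).1 hd m hm,
      coeff_eq_zero_of_natDegree_lt ((natDegree_mpPoly_le ..).trans_lt hm), mul_zero, sub_zero]

/-- Normality of all multi-indices. -/
theorem eq_zero_of_mpOrtho {t₁ t₂ : ℝ} (h₁ : |t₁| < Real.pi / 2)
    (h₂ : |t₂| < Real.pi / 2) (hne : t₁ ≠ t₂) {lam : ℝ} (hlam : 0 < lam) {k₁ k₂ : ℕ} {Q : ℂ[X]}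
    (hd : Q.degree < (k₁ + k₂ : ℕ)) (o₁ : MPOrtho lam t₁ k₁ Q) (o₂ : MPOrtho lam t₂ k₂ Q) :
    Q = 0 := by
  induction hk : k₁ + k₂ generalizing k₁ k₂ Q with
  | zero => simpa [hk, Nat.WithBot.lt_zero_iff] using hd
  | succ k ih =>
    obtain ⟨k₁, rfl⟩ | ⟨k₂, rfl⟩ : (∃ j, k₁ = j + 1) ∨ ∃ j, k₂ = j + 1 := by
      rcases k₁ with _ | k₁
      · exact Or.inr ⟨k, by omega⟩
      · exact Or.inl ⟨k₁, rfl⟩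
    · have e := eq_C_mul_mpPoly_of_mpOrtho h₁ h₂ hlam (by rwa [add_right_comm] at hd)
        (o₁.mono (Nat.le_succ _)) o₂ fun R d a b => ih d a b (by omega)
      -- The extra orthogonality relation tests against a moment that is nonzero for `mpPoly`, so
      -- the scalar must vanish.
      have h0 := o₁ (X ^ k₁) (by rw [degree_X_pow]; exact_mod_cast k₁.lt_succ_self)
      rw [e, mul_assoc, mpIntegral_C_mul] at h0
      rw [e, (mul_eq_zero.1 h0).resolve_right
        (mpIntegral_mpPoly_mul_pow_ne_zero h₁ h₂ hne k₁ k₂ hlam).1, C_0, zero_mul]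
    · have e := eq_C_mul_mpPoly_of_mpOrtho h₁ h₂ hlam (by rwa [← add_assoc] at hd)
        o₁ (o₂.mono (Nat.le_succ _)) fun R d a b => ih d a b (by omega)
      have h0 := o₂ (X ^ k₂) (by rw [degree_X_pow]; exact_mod_cast k₂.lt_succ_self)
      rw [e, mul_assoc, mpIntegral_C_mul] at h0
      rw [e, (mul_eq_zero.1 h0).resolve_right
        (mpIntegral_mpPoly_mul_pow_ne_zero h₁ h₂ hne k₁ k₂ hlam).2, C_0, zero_mul]

/-! ### Moment identities that determine the coefficients `b` and `c`. -/

theorem tan_sub_tan_eq {t₁ t₂ : ℝ} (c₁ : Real.cos t₁ ≠ 0) (c₂ : Real.cos t₂ ≠ 0) :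
    Real.tan t₁ - Real.tan t₂ = Real.sin (t₁ - t₂) / (Real.cos t₁ * Real.cos t₂) := by
  rw [Real.tan_eq_sin_div_cos, Real.tan_eq_sin_div_cos, Real.sin_sub]
  field_simp

theorem mpIntegral_mpPoly_fst_eq_mpC_mul {t₁ t₂ : ℝ} (h₁ : |t₁| < Real.pi / 2)
    (h₂ : |t₂| < Real.pi / 2) {lam : ℝ} (hlam : 0 < lam) (k₁ k₂ : ℕ) :
    mpIntegral lam t₁ (mpPoly t₁ t₂ (k₁ + 1) (k₂ + 1) lam * X ^ (k₁ + 1)) =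
      mpC lam t₁ t₂ (k₁ + 1) (k₂ + 1) *
        mpIntegral lam t₁ (mpPoly t₁ t₂ k₁ k₂ lam * X ^ k₁) := by
  have c₁ := (cos_pos_of_abs_lt h₁).ne'
  have c₂ := (cos_pos_of_abs_lt h₂).ne'
  have e : lam + (((k₁ + 1 : ℕ) : ℝ) + (k₂ + 1 : ℕ)) / 2 =
      lam + ((k₁ : ℝ) + k₂) / 2 + 1 / 2 + 1 / 2 := by push_cast; ring
  rw [mpIntegral_mpPoly_mul_pow_fst h₁ h₂ _ _ hlam, mpIntegral_mpPoly_mul_pow_fst h₁ h₂ _ _ hlam, e,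
    mpIntegral_one_add_half (by positivity) h₁ c₁, mpIntegral_one_add_half (by positivity) h₁ c₁]
  simp only [← mul_assoc, ← Complex.ofReal_mul]
  congr 2
  rw [mpC, tan_sub_tan_eq c₁ c₂, Nat.factorial_succ]
  simp only [pow_succ, div_pow, mul_pow]
  push_cast
  field_simp
  ring

theorem mpIntegral_mpPoly_fst_zero {t₁ t₂ : ℝ} (h₁ : |t₁| < Real.pi / 2)
    (h₂ : |t₂| < Real.pi / 2) {lam : ℝ} (hlam : 0 < lam) (k₁ : ℕ) :
    mpIntegral lam t₁ (mpPoly t₁ t₂ (k₁ + 1) 0 lam * X ^ (k₁ + 1)) =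
      mpB lam t₁ t₂ (k₁ + 1) 0 * mpIntegral lam t₁ (mpPoly t₁ t₂ k₁ 0 lam * X ^ k₁) := by
  have c₁ := (cos_pos_of_abs_lt h₁).ne'
  have e : lam + (((k₁ + 1 : ℕ) : ℝ) + (0 : ℕ)) / 2 =
      lam + ((k₁ : ℝ) + (0 : ℕ)) / 2 + 1 / 2 := by push_cast; ring
  rw [mpIntegral_mpPoly_mul_pow_fst h₁ h₂ _ _ hlam, mpIntegral_mpPoly_mul_pow_fst h₁ h₂ _ _ hlam, e,
    mpIntegral_one_add_half (by positivity) h₁ c₁]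
  simp only [← mul_assoc, ← Complex.ofReal_mul]
  congr 2
  rw [mpB, Nat.factorial_succ]
  simp only [pow_succ, div_pow, mul_pow]
  push_cast
  field_simp
  ring

theorem mpIntegral_mpPoly_snd_zero {t₁ t₂ : ℝ} (h₁ : |t₁| < Real.pi / 2)
    (h₂ : |t₂| < Real.pi / 2) {lam : ℝ} (hlam : 0 < lam) (k₂ : ℕ) :
    mpIntegral lam t₂ (mpPoly t₁ t₂ 0 (k₂ + 1) lam * X ^ (k₂ + 1)) =
      mpB lam t₁ t₂ 0 (k₂ + 1) * mpIntegral lam t₂ (mpPoly t₁ t₂ 0 k₂ lam * X ^ k₂) := by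
  have c₂ := (cos_pos_of_abs_lt h₂).ne'
  have e : lam + (((0 : ℕ) : ℝ) + (k₂ + 1 : ℕ)) / 2 =
      lam + ((0 : ℕ) + (k₂ : ℝ)) / 2 + 1 / 2 := by push_cast; ring
  rw [mpIntegral_mpPoly_mul_pow_snd h₁ h₂ _ _ hlam, mpIntegral_mpPoly_mul_pow_snd h₁ h₂ _ _ hlam, e,
    mpIntegral_one_add_half (by positivity) h₂ c₂]
  simp only [← mul_assoc, ← Complex.ofReal_mul]
  congr 2
  rw [mpB, Nat.factorial_succ]
  simp only [pow_succ, div_pow, mul_pow]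
  push_cast
  field_simp
  ring

/-- The `c` term cancels exactly the `1 / cos² t₁` part of `b`; the `1 / cos² t₂` part accounts for
the moment on the left. -/
theorem mpIntegral_mpPoly_snd_eq {t₁ t₂ : ℝ} (h₁ : |t₁| < Real.pi / 2)
    (h₂ : |t₂| < Real.pi / 2) {lam : ℝ} (hlam : 0 < lam) (k₁ k₂ : ℕ) :
    mpIntegral lam t₂ (mpPoly t₁ t₂ (k₁ + 1) (k₂ + 1) lam * X ^ (k₂ + 1)) =
      mpB lam t₁ t₂ (k₁ + 1) (k₂ + 1) *
          mpIntegral lam t₂ (mpPoly t₁ t₂ (k₁ + 1) k₂ lam * X ^ k₂) +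
        mpC lam t₁ t₂ (k₁ + 1) (k₂ + 1) *
          mpIntegral lam t₂ (mpPoly t₁ t₂ k₁ k₂ lam * X ^ k₂) := by
  have c₁ := (cos_pos_of_abs_lt h₁).ne'
  have c₂ := (cos_pos_of_abs_lt h₂).ne'
  have e : lam + (((k₁ + 1 : ℕ) : ℝ) + (k₂ + 1 : ℕ)) / 2 =
      lam + ((k₁ : ℝ) + k₂) / 2 + 1 / 2 + 1 / 2 := by push_cast; ring
  have e' : lam + (((k₁ + 1 : ℕ) : ℝ) + k₂) / 2 =
      lam + ((k₁ : ℝ) + k₂) / 2 + 1 / 2 := by push_cast; ring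
  rw [mpIntegral_mpPoly_mul_pow_snd h₁ h₂ _ _ hlam, mpIntegral_mpPoly_mul_pow_snd h₁ h₂ _ _ hlam,
    mpIntegral_mpPoly_mul_pow_snd h₁ h₂ _ _ hlam, e, e',
    mpIntegral_one_add_half (by positivity) h₂ c₂, mpIntegral_one_add_half (by positivity) h₂ c₂]
  simp only [← mul_assoc, ← Complex.ofReal_mul]
  rw [← add_mul, ← Complex.ofReal_add]
  congr 2
  rw [mpC, mpB, tan_sub_tan_eq c₁ c₂, Nat.factorial_succ, ← neg_sub t₂ t₁, Real.sin_neg]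
  simp only [pow_succ, div_pow, mul_pow]
  push_cast
  field_simp
  ring

/-! ### The recurrences for the constructed polynomials. -/

/-- Multiplication by `X` costs one order of orthogonality, and equality of a single moment restores
it. -/
theorem MPOrtho.X_mul_sub {lam t : ℝ} (hlam : 0 < lam) (ht : |t| < Real.pi / 2) {n : ℕ}
    {P R : ℂ[X]} (hP : MPOrtho lam t (n + 1) P) (hR : MPOrtho lam t n R)
    (h : mpIntegral lam t (P * X ^ (n + 1)) = mpIntegral lam t (R * X ^ n)) :
    MPOrtho lam t (n + 1) (X * P - R) := fun r hr => by
  have hr' : r.natDegree ≤ n := natDegree_le_iff_coeff_eq_zero.2 fun j hj =>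
    (degree_lt_iff_coeff_zero _ _).1 hr j hj
  have hX : (X * r).natDegree ≤ n + 1 := by
    rw [add_comm]
    exact natDegree_mul_le_of_le natDegree_X_le hr'
  rw [sub_mul, mpIntegral_sub hlam ht, show X * P * r = P * (X * r) by ring,
    hP.mpIntegral_mul hlam ht hX, hR.mpIntegral_mul hlam ht hr', coeff_X_mul, h, sub_self]

/-- To verify a recurrence for `mpPoly` it suffices to check the orthogonality relations of the
remainder `X * P - R`. -/
theorem mpPoly_succ_eq_of_mpOrtho {t₁ t₂ : ℝ} (h₁ : |t₁| < Real.pi / 2)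
    (h₂ : |t₂| < Real.pi / 2) (hne : t₁ ≠ t₂) {lam : ℝ} (hlam : 0 < lam) {k₁ k₂ : ℕ} {R : ℂ[X]}
    (hd : R.degree < (k₁ + k₂ : ℕ))
    (o₁ : MPOrtho lam t₁ k₁ (X * mpPoly t₁ t₂ k₁ k₂ lam - R))
    (o₂ : MPOrtho lam t₂ k₂ (X * mpPoly t₁ t₂ k₁ k₂ lam - R)) :
    mpPoly t₁ t₂ (k₁ + 1) k₂ lam =
      (X - C (mpA lam t₁ t₂ k₁ k₂ : ℂ)) * mpPoly t₁ t₂ k₁ k₂ lam - R := by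
  have o := mpOrtho_mpPoly h₁ h₂ k₁ k₂ hlam
  have o' := mpOrtho_mpPoly h₁ h₂ (k₁ + 1) k₂ hlam
  have hE := eq_zero_of_mpOrtho h₁ h₂ hne hlam (k₁ := k₁) (k₂ := k₂)
    (Q := X * mpPoly t₁ t₂ k₁ k₂ lam - R - C (mpA lam t₁ t₂ k₁ k₂ : ℂ) * mpPoly t₁ t₂ k₁ k₂ lam -
      mpPoly t₁ t₂ (k₁ + 1) k₂ lam) ?_
    ((o₁.sub hlam h₁ (o.1.C_mul _)).sub hlam h₁ (o'.1.mono k₁.le_succ))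
    ((o₂.sub hlam h₂ (o.2.C_mul _)).sub hlam h₂ o'.2)
  · linear_combination -hE
  refine (degree_lt_iff_coeff_zero _ _).2 fun m hm => ?_
  have hP := natDegree_mpPoly_le t₁ t₂ k₁ k₂ lam
  have hP' := natDegree_mpPoly_le t₁ t₂ (k₁ + 1) k₂ lam
  simp only [coeff_sub, coeff_C_mul, (degree_lt_iff_coeff_zero _ _).1 hd m hm, sub_zero]
  rcases hm.eq_or_lt with rfl | hm
  -- `mpA` is the difference of the subleading coefficients at the indices `(k₁, k₂)` and `(k₁ + 1,
  -- k₂)`.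
  · have hX := coeff_X_mul_mpPoly h₁ h₂ (k₁ + 1) k₂ lam
    rw [add_right_comm, coeff_X_mul] at hX
    rw [hX, coeff_X_mul_mpPoly h₁ h₂, coeff_mpPoly_top h₁ h₂, mul_one, ← Complex.ofReal_sub,
      ← Complex.ofReal_sub, mpA, Complex.ofReal_eq_zero]
    push_cast
    ring
  · obtain ⟨m, rfl⟩ : ∃ j, m = j + 1 := ⟨m - 1, by omega⟩
    rw [coeff_X_mul, coeff_eq_zero_of_natDegree_lt (hP.trans_lt hm), mul_zero, sub_zero]
    rcases (Nat.lt_succ_iff.1 hm).eq_or_lt with rfl | hm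
    · have := coeff_mpPoly_top h₁ h₂ (k₁ + 1) k₂ lam
      rw [add_right_comm] at this
      rw [coeff_mpPoly_top h₁ h₂, this, sub_self]
    · rw [coeff_eq_zero_of_natDegree_lt (hP.trans_lt hm),
        coeff_eq_zero_of_natDegree_lt (hP'.trans_lt (by omega)), sub_zero]

theorem degree_C_mul_mpPoly_lt (t₁ t₂ lam : ℝ) (a : ℂ) {k₁ k₂ k : ℕ} (h : k₁ + k₂ < k) :
    (C a * mpPoly t₁ t₂ k₁ k₂ lam).degree < k :=
  (degree_lt_iff_coeff_zero _ _).2 fun _ hm => coeff_eq_zero_of_natDegree_lt <|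
    (natDegree_C_mul_le _ _).trans_lt <|
      (natDegree_mpPoly_le ..).trans_lt (h.trans_le hm)

theorem mpPoly_recurrence {t₁ t₂ : ℝ} (h₁ : |t₁| < Real.pi / 2)
    (h₂ : |t₂| < Real.pi / 2) (hne : t₁ ≠ t₂) {lam : ℝ} (hlam : 0 < lam) (k₁ k₂ : ℕ) :
    mpPoly t₁ t₂ (k₁ + 1 + 1) (k₂ + 1) lam =
      (X - C (mpA lam t₁ t₂ (k₁ + 1) (k₂ + 1) : ℂ)) * mpPoly t₁ t₂ (k₁ + 1) (k₂ + 1) lam -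
        C (mpB lam t₁ t₂ (k₁ + 1) (k₂ + 1) : ℂ) * mpPoly t₁ t₂ (k₁ + 1) k₂ lam -
        C (mpC lam t₁ t₂ (k₁ + 1) (k₂ + 1) : ℂ) * mpPoly t₁ t₂ k₁ k₂ lam := by
  have o := mpOrtho_mpPoly h₁ h₂ (k₁ + 1) (k₂ + 1) hlam
  have o' := mpOrtho_mpPoly h₁ h₂ (k₁ + 1) k₂ hlam
  have o'' := mpOrtho_mpPoly h₁ h₂ k₁ k₂ hlam
  set b : ℂ := ((mpB lam t₁ t₂ (k₁ + 1) (k₂ + 1) : ℝ) : ℂ)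
  set c : ℂ := ((mpC lam t₁ t₂ (k₁ + 1) (k₂ + 1) : ℝ) : ℂ)
  have hs : ∀ t r, |t| < Real.pi / 2 →
      mpIntegral lam t ((C b * mpPoly t₁ t₂ (k₁ + 1) k₂ lam + C c * mpPoly t₁ t₂ k₁ k₂ lam) * r) =
        b * mpIntegral lam t (mpPoly t₁ t₂ (k₁ + 1) k₂ lam * r) +
          c * mpIntegral lam t (mpPoly t₁ t₂ k₁ k₂ lam * r) := fun t r ht => by
    rw [add_mul, mpIntegral_add hlam ht, mul_assoc, mul_assoc, mpIntegral_C_mul, mpIntegral_C_mul]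
  rw [sub_sub]
  refine mpPoly_succ_eq_of_mpOrtho h₁ h₂ hne hlam
    ((degree_add_le _ _).trans_lt (max_lt (degree_C_mul_mpPoly_lt _ _ _ _ (by omega))
      (degree_C_mul_mpPoly_lt _ _ _ _ (by omega))))
    (o.1.X_mul_sub hlam h₁ (fun r hr => ?_) ?_) (o.2.X_mul_sub hlam h₂ (fun r hr => ?_) ?_)
  · rw [hs _ _ h₁, o'.1.mono k₁.le_succ r hr, o''.1 r hr, mul_zero, mul_zero, add_zero]
  -- The `b` term vanishes here by orthogonality, so this condition involves `c` alone.
  · rw [hs _ _ h₁, o'.1 _ (by rw [degree_X_pow]; exact_mod_cast k₁.lt_succ_self), mul_zero,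
      zero_add, mpIntegral_mpPoly_fst_eq_mpC_mul h₁ h₂ hlam]
  · rw [hs _ _ h₂, o'.2 r hr, o''.2 r hr, mul_zero, mul_zero, add_zero]
  · rw [hs _ _ h₂, mpIntegral_mpPoly_snd_eq h₁ h₂ hlam]

theorem mpPoly_one_succ {t₁ t₂ : ℝ} (h₁ : |t₁| < Real.pi / 2)
    (h₂ : |t₂| < Real.pi / 2) (hne : t₁ ≠ t₂) {lam : ℝ} (hlam : 0 < lam) (k₂ : ℕ) :
    mpPoly t₁ t₂ 1 (k₂ + 1) lam =
      (X - C (mpA lam t₁ t₂ 0 (k₂ + 1) : ℂ)) * mpPoly t₁ t₂ 0 (k₂ + 1) lam -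
        C (mpB lam t₁ t₂ 0 (k₂ + 1) : ℂ) * mpPoly t₁ t₂ 0 k₂ lam := by
  have o := mpOrtho_mpPoly h₁ h₂ 0 (k₂ + 1) hlam
  have o' := mpOrtho_mpPoly h₁ h₂ 0 k₂ hlam
  refine mpPoly_succ_eq_of_mpOrtho h₁ h₂ hne hlam (degree_C_mul_mpPoly_lt _ _ _ _ (by omega))
    (MPOrtho.zero _ _ _) (o.2.X_mul_sub hlam h₂ (o'.2.C_mul _) ?_)
  rw [mul_assoc, mpIntegral_C_mul, mpIntegral_mpPoly_snd_zero h₁ h₂ hlam]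

theorem mpPoly_succ_zero {t₁ t₂ : ℝ} (h₁ : |t₁| < Real.pi / 2)
    (h₂ : |t₂| < Real.pi / 2) (hne : t₁ ≠ t₂) {lam : ℝ} (hlam : 0 < lam) (k₁ : ℕ) :
    mpPoly t₁ t₂ (k₁ + 1 + 1) 0 lam =
      (X - C (mpA lam t₁ t₂ (k₁ + 1) 0 : ℂ)) * mpPoly t₁ t₂ (k₁ + 1) 0 lam -
        C (mpB lam t₁ t₂ (k₁ + 1) 0 : ℂ) * mpPoly t₁ t₂ k₁ 0 lam := by
  have o := mpOrtho_mpPoly h₁ h₂ (k₁ + 1) 0 hlam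
  have o' := mpOrtho_mpPoly h₁ h₂ k₁ 0 hlam
  refine mpPoly_succ_eq_of_mpOrtho h₁ h₂ hne hlam (degree_C_mul_mpPoly_lt _ _ _ _ (by omega))
    (o.1.X_mul_sub hlam h₁ (o'.1.C_mul _) ?_) (MPOrtho.zero _ _ _)
  rw [mul_assoc, mpIntegral_C_mul, mpIntegral_mpPoly_fst_zero h₁ h₂ hlam]

theorem mpPoly_one_zero {t₁ t₂ : ℝ} (h₁ : |t₁| < Real.pi / 2)
    (h₂ : |t₂| < Real.pi / 2) (hne : t₁ ≠ t₂) {lam : ℝ} (hlam : 0 < lam) :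
    mpPoly t₁ t₂ 1 0 lam = (X - C (mpA lam t₁ t₂ 0 0 : ℂ)) * mpPoly t₁ t₂ 0 0 lam := by
  have := mpPoly_succ_eq_of_mpOrtho h₁ h₂ hne hlam (k₁ := 0) (k₂ := 0) (R := 0)
    (by simp) (MPOrtho.zero _ _ _) (MPOrtho.zero _ _ _)
  rwa [sub_zero] at this

/-! ### Return to real polynomials, and symmetry in the two weights. -/

theorem mpOrtho_of_pow {lam t : ℝ} (hlam : 0 < lam) (ht : |t| < Real.pi / 2) {n : ℕ} {Q : ℂ[X]}
    (h : ∀ m < n, mpIntegral lam t (Q * X ^ m) = 0) : MPOrtho lam t n Q := by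
  induction n with
  | zero => exact MPOrtho.zero _ _ _
  | succ n ih =>
    intro r hr
    have hr' : r.natDegree ≤ n := natDegree_le_iff_coeff_eq_zero.2 fun j hj =>
      (degree_lt_iff_coeff_zero _ _).1 hr j hj
    rw [(ih fun m hm => h m (hm.trans n.lt_succ_self)).mpIntegral_mul hlam ht hr',
      h n n.lt_succ_self, mul_zero]

theorem mpIntegral_map_mul_pow (lam t : ℝ) (P : ℝ[X]) (m : ℕ) :
    mpIntegral lam t (P.map Complex.ofRealHom * X ^ m) =
      ((∫ x : ℝ, P.eval x * x ^ m * mpWeight lam t x : ℝ) : ℂ) := by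
  have := mpIntegral_map lam t (P * X ^ m)
  simpa only [Polynomial.map_mul, Polynomial.map_pow, map_X, eval_mul, eval_pow, eval_X] using this

theorem IsMultipleMP.map_eq {t₁ t₂ : ℝ} (h₁ : |t₁| < Real.pi / 2)
    (h₂ : |t₂| < Real.pi / 2) (hne : t₁ ≠ t₂) {lam : ℝ} (hlam : 0 < lam) {k₁ k₂ : ℕ} {P : ℝ[X]}
    (h : IsMultipleMP lam t₁ t₂ k₁ k₂ P) :
    P.map Complex.ofRealHom = mpPoly t₁ t₂ k₁ k₂ lam := by
  have o := mpOrtho_mpPoly h₁ h₂ k₁ k₂ hlam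
  have o₁ : MPOrtho lam t₁ k₁ (P.map Complex.ofRealHom) := mpOrtho_of_pow hlam h₁ fun m hm => by
    rw [mpIntegral_map_mul_pow, h.orthogonal_fst m hm, Complex.ofReal_zero]
  have o₂ : MPOrtho lam t₂ k₂ (P.map Complex.ofRealHom) := mpOrtho_of_pow hlam h₂ fun m hm => by
    rw [mpIntegral_map_mul_pow, h.orthogonal_snd m hm, Complex.ofReal_zero]
  refine sub_eq_zero.1 (eq_zero_of_mpOrtho h₁ h₂ hne hlam ?_ (o₁.sub hlam h₁ o.1)
    (o₂.sub hlam h₂ o.2))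
  refine (degree_lt_iff_coeff_zero _ _).2 fun m hm => ?_
  rw [coeff_sub, coeff_map]
  rcases hm.eq_or_lt with rfl | hm
  · have := h.monic.coeff_natDegree
    rw [h.natDegree_eq] at this
    rw [coeff_mpPoly_top h₁ h₂, this, map_one, sub_self]
  · rw [coeff_eq_zero_of_natDegree_lt (h.natDegree_eq.trans_lt hm),
      coeff_eq_zero_of_natDegree_lt ((natDegree_mpPoly_le ..).trans_lt hm), map_zero, sub_zero]

theorem exists_isMultipleMP {t₁ t₂ : ℝ} (h₁ : |t₁| < Real.pi / 2)
    (h₂ : |t₂| < Real.pi / 2) {lam : ℝ} (hlam : 0 < lam) (k₁ k₂ : ℕ) :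
    ∃ P : ℝ[X], IsMultipleMP lam t₁ t₂ k₁ k₂ P := by
  have o := mpOrtho_mpPoly h₁ h₂ k₁ k₂ hlam
  -- Invariance under conjugation makes every coefficient real.
  obtain ⟨P, hP⟩ : ∃ P : ℝ[X], P.map Complex.ofRealHom = mpPoly t₁ t₂ k₁ k₂ lam := by
    refine (mem_lifts _).1 ((lifts_iff_coeff_lifts _).2 fun n => ?_)
    have := congrArg (coeff · n) (map_conj_mpPoly t₁ t₂ k₁ k₂ lam)
    simp only [coeff_map] at this
    obtain ⟨r, hr⟩ := Complex.conj_eq_iff_real.1 this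
    exact ⟨r, hr.symm⟩
  have hinj : Function.Injective Complex.ofRealHom := Complex.ofReal_injective
  have hle : P.natDegree ≤ k₁ + k₂ := by
    rw [← natDegree_map_eq_of_injective hinj P, hP]
    exact natDegree_mpPoly_le ..
  have htop : P.coeff (k₁ + k₂) = 1 := hinj (by
    rw [← coeff_map, hP, coeff_mpPoly_top h₁ h₂, map_one])
  have hdeg : P.natDegree = k₁ + k₂ :=
    natDegree_eq_of_le_of_coeff_ne_zero hle (by rw [htop]; exact one_ne_zero)
  refine ⟨P, monic_of_natDegree_le_of_coeff_eq_one _ hle htop, hdeg, fun m hm => ?_,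
    fun m hm => ?_⟩
  · have := o.1 (X ^ m) (by rw [degree_X_pow]; exact_mod_cast hm)
    rwa [← hP, mpIntegral_map_mul_pow, Complex.ofReal_eq_zero] at this
  · have := o.2 (X ^ m) (by rw [degree_X_pow]; exact_mod_cast hm)
    rwa [← hP, mpIntegral_map_mul_pow, Complex.ofReal_eq_zero] at this

theorem map_ofRealHom_injective : Function.Injective (Polynomial.map Complex.ofRealHom) :=
  map_injective _ Complex.ofReal_injective

theorem map_multipleMP {t₁ t₂ : ℝ} (h₁ : |t₁| < Real.pi / 2)
    (h₂ : |t₂| < Real.pi / 2) (hne : t₁ ≠ t₂) {lam : ℝ} (hlam : 0 < lam) (k₁ k₂ : ℕ) :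
    (multipleMP lam t₁ t₂ k₁ k₂).map Complex.ofRealHom = mpPoly t₁ t₂ k₁ k₂ lam :=
  (multipleMP_spec (exists_isMultipleMP h₁ h₂ hlam k₁ k₂)).map_eq h₁ h₂ hne hlam

theorem IsMultipleMP.symm {lam t₁ t₂ : ℝ} {k₁ k₂ : ℕ} {P : ℝ[X]}
    (h : IsMultipleMP lam t₁ t₂ k₁ k₂ P) : IsMultipleMP lam t₂ t₁ k₂ k₁ P :=
  ⟨h.monic, h.natDegree_eq.trans (add_comm _ _), h.orthogonal_snd, h.orthogonal_fst⟩

theorem multipleMP_of_neg_fst (lam t₁ t₂ : ℝ) {k₁ : ℤ} (k₂ : ℤ) (h : k₁ < 0) :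
    multipleMP lam t₁ t₂ k₁ k₂ = 0 :=
  dif_neg fun h' => absurd h'.1 (not_le.2 h)

theorem multipleMP_of_neg_snd (lam t₁ t₂ : ℝ) (k₁ : ℤ) {k₂ : ℤ} (h : k₂ < 0) :
    multipleMP lam t₁ t₂ k₁ k₂ = 0 :=
  dif_neg fun h' => absurd h'.2.1 (not_le.2 h)

/-- `mpPoly` treats the two weights asymmetrically; the symmetry comes from uniqueness, since the
defining conditions are symmetric. -/
theorem multipleMP_comm {t₁ t₂ : ℝ} (h₁ : |t₁| < Real.pi / 2)
    (h₂ : |t₂| < Real.pi / 2) (hne : t₁ ≠ t₂) {lam : ℝ} (hlam : 0 < lam) (k₁ k₂ : ℤ) :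
    multipleMP lam t₁ t₂ k₁ k₂ = multipleMP lam t₂ t₁ k₂ k₁ := by
  rcases lt_or_ge k₁ 0 with h | h
  · rw [multipleMP_of_neg_fst _ _ _ _ h, multipleMP_of_neg_snd _ _ _ _ h]
  rcases lt_or_ge k₂ 0 with h' | h'
  · rw [multipleMP_of_neg_fst _ _ _ _ h', multipleMP_of_neg_snd _ _ _ _ h']
  lift k₁ to ℕ using h
  lift k₂ to ℕ using h'
  refine map_ofRealHom_injective ?_
  rw [map_multipleMP h₂ h₁ hne.symm hlam]
  exact (multipleMP_spec (exists_isMultipleMP h₁ h₂ hlam k₁ k₂)).symm.map_eq h₂ h₁ hne.symm hlam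

theorem multipleMP_succ_left {t₁ t₂ : ℝ} (h₁ : |t₁| < Real.pi / 2)
    (h₂ : |t₂| < Real.pi / 2) (hne : t₁ ≠ t₂) {lam : ℝ} (hlam : 0 < lam) (k₁ k₂ : ℕ)
    (hk : 1 ≤ k₂ ∨ k₁ = 0) :
    multipleMP lam t₁ t₂ (k₁ + 1) k₂ =
      (X - C (mpA lam t₁ t₂ k₁ k₂)) * multipleMP lam t₁ t₂ k₁ k₂
        - C (mpB lam t₁ t₂ k₁ k₂) * multipleMP lam t₁ t₂ k₁ (k₂ - 1)
        - C (mpC lam t₁ t₂ k₁ k₂) * multipleMP lam t₁ t₂ (k₁ - 1) (k₂ - 1) := by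
  have hmap := map_multipleMP h₁ h₂ hne hlam
  refine map_ofRealHom_injective ?_
  simp only [Polynomial.map_sub, Polynomial.map_mul, map_C, map_X, Complex.ofRealHom_eq_coe]
  rw [← Nat.cast_succ k₁, hmap, hmap]
  rcases k₂ with _ | k₂
  -- The boundary hypothesis leaves only the index `(0, 0)`, where both lower-order polynomials are
  -- zero by convention.
  · obtain rfl : k₁ = 0 := hk.resolve_left (by omega)
    rw [multipleMP_of_neg_snd _ _ _ _ (by simp), multipleMP_of_neg_snd _ _ _ _ (by simp),
      mpPoly_one_zero h₁ h₂ hne hlam]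
    simp
  · rw [show ((k₂ + 1 : ℕ) : ℤ) - 1 = (k₂ : ℤ) by push_cast; ring, hmap]
    rcases k₁ with _ | k₁
    · rw [multipleMP_of_neg_fst _ _ _ _ (by simp), mpPoly_one_succ h₁ h₂ hne hlam]
      simp
    · rw [show ((k₁ + 1 : ℕ) : ℤ) - 1 = (k₁ : ℤ) by push_cast; ring, hmap,
        mpPoly_recurrence h₁ h₂ hne hlam]

theorem multipleMP_succ_zero {t₁ t₂ : ℝ} (h₁ : |t₁| < Real.pi / 2)
    (h₂ : |t₂| < Real.pi / 2) (hne : t₁ ≠ t₂) {lam : ℝ} (hlam : 0 < lam) (k₁ : ℕ) :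
    multipleMP lam t₁ t₂ (k₁ + 1) 0 =
      (X - C (mpA lam t₁ t₂ k₁ 0)) * multipleMP lam t₁ t₂ k₁ 0
        - C (mpB lam t₁ t₂ k₁ 0) * multipleMP lam t₁ t₂ (k₁ - 1) 0 := by
  have hmap := fun k => map_multipleMP h₁ h₂ hne hlam k 0
  simp only [Nat.cast_zero] at hmap
  refine map_ofRealHom_injective ?_
  simp only [Polynomial.map_sub, Polynomial.map_mul, map_C, map_X, Complex.ofRealHom_eq_coe]
  rw [← Nat.cast_succ k₁, hmap, hmap]
  rcases k₁ with _ | k₁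
  · rw [multipleMP_of_neg_fst _ _ _ _ (by simp), mpPoly_one_zero h₁ h₂ hne hlam]
    simp
  · rw [show ((k₁ + 1 : ℕ) : ℤ) - 1 = (k₁ : ℤ) by push_cast; ring, hmap,
      mpPoly_succ_zero h₁ h₂ hne hlam]

theorem theorem2p2 (lam t₁ t₂ : ℝ) (hlam : 0 < lam)
    (ht₁ : t₁ ∈ Set.Ioo (-(Real.pi / 2)) (Real.pi / 2))
    (ht₂ : t₂ ∈ Set.Ioo (-(Real.pi / 2)) (Real.pi / 2))
    (hne : t₁ ≠ t₂) :
    -- the multiple Meixner-Pollaczek polynomials are well defined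
    (∀ k₁ k₂ : ℕ, ∃! P : ℝ[X], IsMultipleMP lam t₁ t₂ k₁ k₂ P) ∧
    -- the two four term recurrences
    (∀ k₁ k₂ : ℕ, (1 ≤ k₂ ∨ k₁ = 0) →
      multipleMP lam t₁ t₂ (k₁ + 1) k₂ =
        (X - C (mpA lam t₁ t₂ k₁ k₂)) * multipleMP lam t₁ t₂ k₁ k₂
          - C (mpB lam t₁ t₂ k₁ k₂) * multipleMP lam t₁ t₂ k₁ (k₂ - 1)
          - C (mpC lam t₁ t₂ k₁ k₂) * multipleMP lam t₁ t₂ (k₁ - 1) (k₂ - 1)) ∧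
    (∀ k₁ k₂ : ℕ, (1 ≤ k₁ ∨ k₂ = 0) →
      multipleMP lam t₁ t₂ k₁ (k₂ + 1) =
        (X - C (mpA lam t₂ t₁ k₂ k₁)) * multipleMP lam t₁ t₂ k₁ k₂
          - C (mpB lam t₂ t₁ k₂ k₁) * multipleMP lam t₁ t₂ (k₁ - 1) k₂
          - C (mpC lam t₂ t₁ k₂ k₁) * multipleMP lam t₁ t₂ (k₁ - 1) (k₂ - 1)) ∧
    -- the remaining boundary cases, where only one weight is involved
    (∀ k₁ : ℕ, multipleMP lam t₁ t₂ (k₁ + 1) 0 =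
        (X - C (mpA lam t₁ t₂ k₁ 0)) * multipleMP lam t₁ t₂ k₁ 0
          - C (mpB lam t₁ t₂ k₁ 0) * multipleMP lam t₁ t₂ (k₁ - 1) 0) ∧
    (∀ k₂ : ℕ, multipleMP lam t₁ t₂ 0 (k₂ + 1) =
        (X - C (mpA lam t₂ t₁ k₂ 0)) * multipleMP lam t₁ t₂ 0 k₂
          - C (mpB lam t₂ t₁ k₂ 0) * multipleMP lam t₁ t₂ 0 (k₂ - 1)) := by
  have h₁ := abs_lt.2 ht₁
  have h₂ := abs_lt.2 ht₂
  have comm := multipleMP_comm h₁ h₂ hne hlam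
  refine ⟨fun k₁ k₂ => ?_, multipleMP_succ_left h₁ h₂ hne hlam, fun k₁ k₂ hk => ?_,
    multipleMP_succ_zero h₁ h₂ hne hlam, fun k₂ => ?_⟩
  · obtain ⟨P, hP⟩ := exists_isMultipleMP h₁ h₂ hlam k₁ k₂
    refine ⟨P, hP, fun Q hQ => map_ofRealHom_injective ?_⟩
    rw [hP.map_eq h₁ h₂ hne hlam, hQ.map_eq h₁ h₂ hne hlam]
  · simp only [comm]
    exact multipleMP_succ_left h₂ h₁ hne.symm hlam k₂ k₁ hk
  · simp only [comm]
    exact multipleMP_succ_zero h₂ h₁ hne.symm hlam k₂
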